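/- Model. A tournament tree of size $n$ is a finite rooted binary tree with $n$ leaves, each storing one of $n$ elements, in which every internal node has exactly two children. An access to an element $x$ with $k$ transient fingers starts with all fingers $F_1,\dots,F_k$ at the root (nothing but the tree is kept from earlier accesses) and consists of a sequence of operations, each using one finger $F_i$: (1) move $F_i$ to the parent, left child or right child of its location; (2) copy the location of $F_i$ into a temporary finger $F_0$; (3) move $F_i$ to the location of $F_0$; (4) swap the subtree rooted at $F_0$ with the left or right child subtree of $F_i$'s location (the two subtrees being disjoint); (5) detach the subtree rooted at $F_0$ from its parent and make it the left or right child of $F_i$'s location, if that child pointer is null and $F_i$ is not in the detached subtree; (6) serve the request from $F_i$, if $x$ is stored at its location. The serve operation must be the last one, the tree left by an access must again be a tournament tree, and the cost of the access is its number of operations. Let $\lg^*(n)$ be the least $j\ge 0$ such that the $j$-fold iterated binary logarithm of $n$ is at most $1$. Theorem. There is an absolute constant $C>0$ such that for all integers $n\ge 1$ and $k\ge 2$, for every initial tournament tree of size $n$ and every sequence of $m\ge n$ accesses to its elements, the whole sequence, known in advance (offline), can be served with $k$ transient fingers at total cost at most $$C\, m\left(\log_k n + 2^{\lg^*(n)}\right).$$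 -/

import Mathlib

/-- The two child positions of a node of a binary tree. -/
inductive Side where
  | left
  | right

/-- A pointer-based binary tree with node set `V` and `n` stored elements `0, …, n - 1`:
a root, a (possibly null) left and right child pointer for every node, and for every element the
node that stores it.  The parent of a node is the node one of whose child pointers leads to it. -/
structure PointerTree (V : Type*) (n : ℕ) where
  /-- the root of the tree -/
  root : V
  /-- the child pointers; `none` is the null pointer -/
  child : V → Side → Option V
  /-- the node at which an element is stored -/
  node : Fin n → V

namespace PointerTree

variable {V : Type*} {n : ℕ}

/-- `v` is a child of `u`, i.e. `u` is the parent of `v`. -/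
def IsParent (T : PointerTree V n) (u v : V) : Prop :=
  ∃ s, T.child u s = some v

/-- `v` lies in the subtree with root `u` (the case `u = v` is included). -/
def InSubtree (T : PointerTree V n) (u v : V) : Prop :=
  Relation.ReflTransGen T.IsParent u v

/-- `T` is a tournament tree on its `n` elements: the pointers form a rooted tree on the node
set, each element is stored in a leaf of its own, and every node that stores no element has two
children.  (This is used with a finite node set.) -/
structure IsTournament (T : PointerTree V n) : Prop where
  root_no_parent : ∀ v, ¬ T.IsParent v T.root
  parent_unique : ∀ u s u' s' v,
    T.child u s = some v → T.child u' s' = some v → u = u' ∧ s = s'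
  connected : ∀ v, T.InSubtree T.root v
  node_injective : Function.Injective T.node
  element_leaf : ∀ x s, T.child (T.node x) s = none
  internal_children : ∀ v, (∀ x, T.node x ≠ v) → ∀ s, ∃ w, T.child v s = some w

open Classical in
/-- Exchange the subtrees with roots `b` and `d`: each pointer to `b` is redirected to `d` and
each pointer to `d` is redirected to `b`. -/
noncomputable def swapSubtrees (T : PointerTree V n) (b d : V) : PointerTree V n where
  root := T.root
  child v r := (T.child v r).map (Equiv.swap b d)
  node := T.node

open Classical in
/-- Detach the subtree with root `b` from its parent and make it the child of `a` on side `s`. -/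
noncomputable def moveSubtree (T : PointerTree V n) (b a : V) (s : Side) : PointerTree V n where
  root := T.root
  child v r :=
    if v = a ∧ r = s then some b
    else if T.child v r = some b then none
    else T.child v r
  node := T.node

end PointerTree

/-- A configuration during an access: the current tree, the locations of the fingers
`F₁, …, F_k`, and the location of the temporary finger `F₀` (`none` as long as no location
has been copied into it). -/
structure FingerConfig (V : Type*) (n k : ℕ) where
  tree : PointerTree V n
  finger : Fin k → V
  temp : Option V

namespace FingerConfig

variable {V : Type*} {n k : ℕ}

/-- The configuration at the beginning of an access: all fingers point at the root, and nothing is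
remembered from previous accesses (the fingers are transient). -/
def start (k : ℕ) (T : PointerTree V n) : FingerConfig V n k where
  tree := T
  finger _ := T.root
  temp := none

/-- One operation (other than serving the request) using the finger `i`; each has cost one. -/
inductive Step : FingerConfig V n k → FingerConfig V n k → Prop
  /-- Move the finger to the parent of its location. -/
  | up (c : FingerConfig V n k) (i : Fin k) (v : V) :
      c.tree.IsParent v (c.finger i) →
      Step c { c with finger := Function.update c.finger i v }
  /-- Move the finger to the left or right child of its location. -/
  | down (c : FingerConfig V n k) (i : Fin k) (s : Side) (v : V) :
      c.tree.child (c.finger i) s = some v →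
      Step c { c with finger := Function.update c.finger i v }
  /-- Copy the location of the finger into the temporary finger. -/
  | save (c : FingerConfig V n k) (i : Fin k) :
      Step c { c with temp := some (c.finger i) }
  /-- Move the finger to the location of the temporary finger. -/
  | load (c : FingerConfig V n k) (i : Fin k) (b : V) :
      c.temp = some b →
      Step c { c with finger := Function.update c.finger i b }
  /-- Swap the subtree at the temporary finger with the left or right child of the finger's
  location; the two subtrees have to be disjoint. -/
  | swap (c : FingerConfig V n k) (i : Fin k) (s : Side) (b d : V) :
      c.temp = some b →
      c.tree.child (c.finger i) s = some d →
      ¬ c.tree.InSubtree b d →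
      ¬ c.tree.InSubtree d b →
      Step c { c with tree := c.tree.swapSubtrees b d }
  /-- Detach the subtree at the temporary finger from its parent and make it the left or right
  child of the finger's location, where the pointer has to be null; the finger may not lie in the
  subtree that is moved. -/
  | attach (c : FingerConfig V n k) (i : Fin k) (s : Side) (b p : V) :
      c.temp = some b →
      c.tree.IsParent p b →
      c.tree.child (c.finger i) s = none →
      ¬ c.tree.InSubtree b (c.finger i) →
      Step c { c with tree := c.tree.moveSubtree b (c.finger i) s }

/-- `c.Run x q T'`: from the configuration `c` one can serve the request to the element `x` with
`q` operations, the last of which serves the request, and `T'` is the tree that results. -/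
inductive Run : FingerConfig V n k → Fin n → ℕ → PointerTree V n → Prop
  | serve (c : FingerConfig V n k) (i : Fin k) (x : Fin n) :
      c.finger i = c.tree.node x → Run c x 1 c.tree
  | step (c c' : FingerConfig V n k) (x : Fin n) (q : ℕ) (T' : PointerTree V n) :
      Step c c' → Run c' x q T' → Run c x (q + 1) T'

end FingerConfig

namespace PointerTree

variable {V : Type*} {n : ℕ}

/-- `T.CanServe k A q`: starting with the tree `T`, the access sequence `A` can be served with
`k` transient fingers at total cost `q`.  Each access starts with all fingers at the root of the
tree left by the previous access, and has to leave a tournament tree. -/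
inductive CanServe (k : ℕ) : PointerTree V n → List (Fin n) → ℕ → Prop
  | nil (T : PointerTree V n) : CanServe k T [] 0
  | cons (T T' : PointerTree V n) (x : Fin n) (A : List (Fin n)) (q r : ℕ) :
      (FingerConfig.start k T).Run x q T' → T'.IsTournament →
      CanServe k T' A r → CanServe k T (x :: A) (q + r)

end PointerTree

/-- Iterating the binary logarithm leads to a value that is at most `1`. -/
theorem exists_iterate_logb_le_one (x : ℝ) : ∃ j : ℕ, (Real.logb 2)^[j] x ≤ 1 := by
  obtain ⟨N, hN⟩ := exists_nat_ge x
  induction N generalizing x with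
  | zero => exact ⟨0, by simpa using le_trans hN (by norm_num)⟩
  | succ N ih =>
    by_cases h1 : x ≤ 1
    · exact ⟨0, by simpa using h1⟩
    push Not at h1
    by_cases h2 : x ≤ 2
    · refine ⟨1, ?_⟩
      have h := Real.logb_le_logb_of_le (b := 2) (by norm_num) (by linarith) h2
      simpa using h
    push Not at h2
    have hb := one_add_mul_self_le_rpow_one_add (s := 1) (by norm_num) (p := x - 1) (by linarith)
    have hlog : Real.logb 2 x ≤ x - 1 := by
      rw [Real.logb_le_iff_le_rpow (by norm_num) (by linarith)]
      calc x = 1 + (x - 1) * 1 := by ring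
        _ ≤ (1 + 1 : ℝ) ^ (x - 1) := hb
        _ = 2 ^ (x - 1) := by norm_num
    obtain ⟨j, hj⟩ := ih (Real.logb 2 x) (by push_cast at hN; linarith)
    exact ⟨j + 1, by simpa using hj⟩

open Classical in
/-- The iterated logarithm `lg*`: the least `j` such that the `j`-fold iterated binary logarithm
of `n` is at most `1`. -/
noncomputable def lgStar (n : ℕ) : ℕ :=
  Nat.find (exists_iterate_logb_le_one (n : ℝ))

/-! The access sequence is known, so elements can be filed by the time of their next request. At
time `t`, an element next requested at time `t'` is kept in list `i`, where `i` is the highest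
binary digit in which `t` and `t'` differ. List `i` then receives elements only while digit `i` of
the clock is 0 and loses them only while it is 1, so one sort at the first removal suffices;
afterwards the requested element is always the head. A request thus means two list accesses (take
the element out, file it again), constant work and a share of a sort. One anchor element per list
keeps every list nonempty.

A list is a caterpillar. With `k` fingers on its spine, in-place radix sort orders `s ≤ k ^ D`
subtrees in `O(s D)` operations, that is `O(log_k n)` per element.

The `r = ⌊log₂ n⌋ + 2` lists are themselves the leaves of a tree, accessed by a sequence of twice
the length that is again known in advance. Recursion gives `f(n) = 2 f(r) + O(log_k n)`. The
doubling produces `2 ^ lg*`, and the logarithmic terms sum geometrically because `4 log_k r ≤ log_k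
n`. The sequence is cut into pieces of length `n`, so that `r` digits suffice for the clock and each
full piece pays for its own set-up; the set-up of the last piece is absorbed by `m ≥ n`.

The argument runs on abstract trees (`Reach`, `Serves`) and is transferred to pointers by
`Reach.realizes` and `Serves.canServe`, using subtree swaps only. Its core is
`ArrayMoves.exists_sort`, `Scheduled.exists_virtual`, `ServedWithin.step` and
`servedWithin_iterate`. -/

/-! ### Abstract trees and their rearrangements -/

/-- Binary trees with labelled leaves. -/
inductive LeafTree (α : Type*) where
  | leaf (a : α)
  | node (l r : LeafTree α)

namespace LeafTree

variable {α β : Type*} {k : ℕ}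

/-- The labels of the leaves from left to right. -/
def leaves : LeafTree α → List α
  | leaf a => [a]
  | node l r => l.leaves ++ r.leaves

/-- Replace every leaf by a tree. -/
def bind (f : α → LeafTree β) : LeafTree α → LeafTree β
  | leaf a => f a
  | node l r => node (l.bind f) (r.bind f)

/-- The caterpillar whose spine carries the trees of `L` and ends in `e`. -/
def comb (L : List (LeafTree α)) (e : LeafTree α) : LeafTree α := L.foldr node e

@[simp] theorem comb_nil (e : LeafTree α) : comb [] e = e := rfl

@[simp] theorem comb_cons (x : LeafTree α) (L : List (LeafTree α)) (e : LeafTree α) :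
    comb (x :: L) e = node x (comb L e) := rfl

theorem bind_comb (f : α → LeafTree β) (L : List (LeafTree α)) (e : LeafTree α) :
    (comb L e).bind f = comb (L.map (bind f)) (e.bind f) := by
  induction L with
  | nil => rfl
  | cons x L ih => simp [bind, ih]

theorem leaves_comb (L : List (LeafTree α)) (e : LeafTree α) :
    (comb L e).leaves = L.flatMap leaves ++ e.leaves := by
  induction L with
  | nil => rfl
  | cons x L ih => simp [leaves, ih]

theorem leaves_ne_nil (t : LeafTree α) : t.leaves ≠ [] := by
  induction t with
  | leaf a => simp [leaves]
  | node l r hl _ => simp [leaves, hl]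

/-- `Reach k t t' c`: with `k` fingers the tree `t` can be turned into `t'` by `c` operations, where
the main finger begins and ends at the root. -/
inductive Reach (k : ℕ) : LeafTree α → LeafTree α → ℕ → Prop
  | refl (t : LeafTree α) : Reach k t t 0
  | trans {t t' t'' : LeafTree α} {c c' : ℕ} :
      Reach k t t' c → Reach k t' t'' c' → Reach k t t'' (c + c')
  | weaken {t t' : LeafTree α} {c c' : ℕ} : Reach k t t' c → c ≤ c' → Reach k t t' c'
  | left {l l' : LeafTree α} {c : ℕ} (r : LeafTree α) :
      Reach k l l' c → Reach k (node l r) (node l' r) (c + 2)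
  | right {r r' : LeafTree α} {c : ℕ} (l : LeafTree α) :
      Reach k r r' c → Reach k (node l r) (node l r') (c + 2)
  | flip (l r : LeafTree α) : Reach k (node l r) (node r l) 4
  | exch (a b c : LeafTree α) : Reach k (node (node a b) c) (node (node c b) a) 6
  | sort (L L' : List (LeafTree α)) (e : LeafTree α) (D : ℕ) :
      L.Perm L' → L.length ≤ k ^ D → Reach k (comb L e) (comb L' e) (20 * L.length * D)

/-- All moves treat subtrees as black boxes. Hence a rearrangement of the tree of lists costs the
same once its leaves are replaced by the lists themselves, which is what makes the recursion
possible. -/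
theorem Reach.bind (f : α → LeafTree β) {t t' : LeafTree α} {c : ℕ} (h : Reach k t t' c) :
    Reach k (t.bind f) (t'.bind f) c := by
  induction h with
  | refl t => exact .refl _
  | trans _ _ h h' => exact h.trans h'
  | weaken _ hc h => exact h.weaken hc
  | left r _ h => exact h.left _
  | right l _ h => exact h.right _
  | flip l r => exact .flip _ _
  | exch a b c => exact .exch _ _ _
  | sort L L' e D hL hD =>
    rw [bind_comb, bind_comb]
    simpa using Reach.sort (k := k) _ _ (e.bind f) D (hL.map (LeafTree.bind f)) (by simpa using hD)

theorem Reach.leaves_perm {t t' : LeafTree α} {c : ℕ} (h : Reach k t t' c) :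
    t.leaves.Perm t'.leaves := by
  induction h with
  | refl t => exact .refl _
  | trans _ _ h h' => exact h.trans h'
  | weaken _ _ h => exact h
  | left r _ h => exact h.append_right _
  | right l _ h => exact h.append_left _
  | flip l r => exact List.perm_append_comm
  | exch a b c =>
    simp only [leaves]
    calc (a.leaves ++ b.leaves ++ c.leaves).Perm (c.leaves ++ (a.leaves ++ b.leaves)) :=
          List.perm_append_comm
      _ |>.Perm (c.leaves ++ (b.leaves ++ a.leaves)) := List.perm_append_comm.append_left _
      _ = _ := by simp
  | sort L L' e D hL hD =>
    rw [leaves_comb, leaves_comb]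
    exact (hL.flatMap_right _).append_right _

/-- A rotation is an exchange followed by a flip at the root and a flip at the right child: 6 + 4 +
(4 + 2). -/
theorem Reach.assoc (a b c : LeafTree α) :
    Reach k (node (node a b) c) (node a (node b c)) 16 :=
  ((Reach.exch a b c).trans (Reach.flip _ _)).trans ((Reach.flip c b).right a)

theorem Reach.assoc_symm (a b c : LeafTree α) :
    Reach k (node a (node b c)) (node (node a b) c) 16 :=
  (((Reach.flip b c).right a).trans (Reach.flip _ _)).trans (Reach.exch _ _ _)

theorem Reach.left_comm (a b c : LeafTree α) :
    Reach k (node a (node b c)) (node b (node a c)) 38 :=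
  ((Reach.assoc_symm a b c).trans ((Reach.flip a b).left c)).trans (Reach.assoc _ _ _)

/-- The caterpillar of the leaves `a :: L`. -/
def chain (a : α) : List α → LeafTree α
  | [] => leaf a
  | x :: L => node (leaf a) (chain x L)

theorem chain_append_singleton (a : α) (L : List α) (z : α) :
    chain a (L ++ [z]) = comb ((a :: L).map leaf) (leaf z) := by
  induction L generalizing a with
  | nil => rfl
  | cons x L ih => simp [chain, ih]

theorem comb_chain (a : α) (L : List α) (K : List α) (z : α) :
    chain a (K ++ z :: L) = comb ((a :: K).map leaf) (chain z L) := by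
  induction K generalizing a with
  | nil => rfl
  | cons x K ih => simp [chain, ih]

theorem Reach.chain_out (a x : α) (L : List α) :
    Reach k (chain a (x :: L)) (node (leaf x) (chain a L)) 38 := by
  cases L with
  | nil => exact (Reach.flip _ _).weaken (by norm_num)
  | cons y L => exact Reach.left_comm _ _ _

theorem Reach.chain_in (a x : α) (L : List α) :
    Reach k (node (leaf x) (chain a L)) (chain a (x :: L)) 38 := by
  cases L with
  | nil => exact (Reach.flip _ _).weaken (by norm_num)
  | cons y L => exact Reach.left_comm _ _ _

theorem Reach.chain_sink (a : α) (L : List α) :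
    Reach k (chain a L) (comb (L.map leaf) (leaf a)) (40 * L.length) := by
  induction L with
  | nil => exact .refl _
  | cons x L ih =>
    exact ((Reach.chain_out a x L).trans (ih.right _)).weaken (by simp; omega)

theorem Reach.chain_float (a : α) (L : List α) :
    Reach k (comb (L.map leaf) (leaf a)) (chain a L) (40 * L.length) := by
  induction L with
  | nil => exact .refl _
  | cons x L ih =>
    exact ((ih.right _).trans (Reach.chain_in a x L)).weaken (by simp; omega)

/-- Sorting fixes the end of the spine, so the anchor is sunk there, the remaining leaves are
sorted, and the anchor floats back. -/
theorem Reach.chain_perm (a : α) {L L' : List α} {D : ℕ} (h : L.Perm L') (hD : L.length ≤ k ^ D) :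
    Reach k (chain a L) (chain a L') ((20 * D + 80) * L.length) := by
  have h1 := Reach.sort (k := k) (L.map leaf) (L'.map leaf) (leaf a) D (h.map leaf) (by simpa using hD)
  refine (((Reach.chain_sink a L).trans h1).trans (Reach.chain_float a L')).weaken (le_of_eq ?_)
  simp only [List.length_map, h.length_eq]
  ring

/-- The head `x` is parked as left child of the root, where it can be served, and the rest is again
a tree of lists. -/
theorem Reach.pop (a x : α) (L : List α) (m : LeafTree α) :
    Reach k (node (chain a (x :: L)) m) (node (leaf x) (node (chain a L) m)) 56 :=
  ((Reach.chain_out a x L).left m).trans (Reach.assoc _ _ _)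

theorem Reach.push (a x : α) (L : List α) (m : LeafTree α) :
    Reach k (node (leaf x) (node (chain a L) m)) (node (chain a (x :: L)) m) 56 :=
  (Reach.assoc_symm _ _ _).trans ((Reach.chain_in a x L).left m)

/-- `x` is stored at the root or at the left child of the root. -/
def Top (x : α) (t : LeafTree α) : Prop := t = leaf x ∨ ∃ r, t = node (leaf x) r

/-- Each level costs at most a flip, a rotation and one descent: 4 + 16 + 2 = 22. -/
theorem Reach.bring {x : α} {t : LeafTree α} (hx : x ∈ t.leaves) :
    ∃ t', Reach k t t' (22 * t.leaves.length) ∧ Top x t' := by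
  induction t with
  | leaf a =>
    obtain rfl : x = a := by simpa [leaves] using hx
    exact ⟨_, (Reach.refl _).weaken (by omega), .inl rfl⟩
  | node l r hl hr =>
    have key : ∀ l r : LeafTree α, (∃ l', Reach k l l' (22 * l.leaves.length) ∧ Top x l') →
        ∃ t', Reach k (node l r) t' (22 * l.leaves.length + 18) ∧ Top x t' := by
      rintro l r ⟨l', h, rfl | ⟨s, rfl⟩⟩
      · exact ⟨_, (h.left r).weaken (by omega), .inr ⟨_, rfl⟩⟩
      · exact ⟨_, (h.left r).trans (Reach.assoc _ _ _), .inr ⟨_, rfl⟩⟩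
    have p1 := List.length_pos_iff.2 l.leaves_ne_nil
    have p2 := List.length_pos_iff.2 r.leaves_ne_nil
    rcases List.mem_append.1 (by simpa [leaves] using hx : x ∈ l.leaves ++ r.leaves) with h | h
    · obtain ⟨t', h1, h2⟩ := key l r (hl h)
      exact ⟨t', h1.weaken (by simp [leaves]; omega), h2⟩
    · obtain ⟨t', h1, h2⟩ := key r l (hr h)
      exact ⟨t', ((Reach.flip l r).trans h1).weaken (by simp [leaves]; omega), h2⟩

theorem Reach.comb_congr (L : List (LeafTree α)) {e e' : LeafTree α} {c : ℕ} (h : Reach k e e' c) :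
    Reach k (comb L e) (comb L e') (c + 2 * L.length) := by
  induction L with
  | nil => exact h
  | cons x L ih => exact (ih.right x).weaken (by simp; omega)

theorem comb_append (L L' : List (LeafTree α)) (e : LeafTree α) :
    comb (L ++ L') e = comb L (comb L' e) := by
  simp [comb]

/-- Every internal node of `t` is removed by one rotation, and 2 more operations pay for working one
step further down the spine. -/
theorem Reach.flatten_left (t e : LeafTree α) :
    Reach k (node t e) (comb (t.leaves.map leaf) e) (18 * (t.leaves.length - 1)) := by
  induction t generalizing e with
  | leaf a => exact Reach.refl _
  | node l r hl hr =>
    have h := ((Reach.assoc l r e).trans ((hr e).right l)).trans (hl _)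
    rw [← comb_append, ← List.map_append] at h
    have p1 := List.length_pos_iff.2 l.leaves_ne_nil
    have p2 := List.length_pos_iff.2 r.leaves_ne_nil
    exact h.weaken (by simp only [leaves, List.length_append]; omega)

theorem Reach.flatten (t : LeafTree α) :
    ∃ L z, t.leaves = L ++ [z] ∧ Reach k t (comb (L.map leaf) (leaf z)) (20 * t.leaves.length) := by
  induction t with
  | leaf a => exact ⟨[], a, rfl, (Reach.refl _).weaken (by omega)⟩
  | node l r _ hr =>
    obtain ⟨L, z, h, hR⟩ := hr
    refine ⟨l.leaves ++ L, z, by simp [leaves, h], ?_⟩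
    have h := (Reach.flatten_left (k := k) l r).trans (hR.comb_congr (l.leaves.map leaf))
    rw [← comb_append, ← List.map_append] at h
    exact h.weaken (by simp only [leaves, List.length_append, List.length_map]; omega)

/-- Every tree can be rearranged into any caterpillar with the same leaves. -/
theorem Reach.arrange {t : LeafTree α} {a : α} {L : List α} {D : ℕ} (h : t.leaves.Perm (a :: L))
    (hD : L.length ≤ k ^ D) : Reach k t (chain a L) ((20 * D + 124) * t.leaves.length) := by
  have ha : a ∈ t.leaves := h.symm.subset (by simp)
  obtain ⟨t', h1, ht'⟩ := Reach.bring (k := k) ha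
  have hp := h1.leaves_perm.symm.trans h
  have hlen := h.length_eq
  rcases ht' with rfl | ⟨r, rfl⟩
  · obtain rfl : L = [] := by simpa [leaves] using hp
    exact h1.weaken (by gcongr; omega)
  · obtain ⟨L', z, hL', hr⟩ := Reach.flatten (k := k) r
    have hp' : (L' ++ [z]).Perm L := by
      rw [← hL']; exact (List.perm_cons a).1 (by simpa [leaves] using hp)
    have h2 := hr.right (leaf a)
    rw [← comb_cons, ← List.map_cons, ← chain_append_singleton] at h2
    have h3 := Reach.chain_perm (k := k) a hp' (by rw [hp'.length_eq]; exact hD)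
    -- Bringing `a` up costs 22 per leaf, flattening 20, permuting `20 * D + 80`; the descent costs
    -- 2 more.
    refine ((h1.trans h2).trans h3).weaken ?_
    rw [hL', hp'.length_eq, hlen, List.length_cons]
    nlinarith

/-! ### Access sequences on abstract trees -/

/-- `Serves k t A t' c`: by rearrangements of total cost `c` that bring one element after the other
to the top, the tree `t` becomes `t'` while the elements of `A` are on top in turn. -/
inductive Serves (k : ℕ) : LeafTree α → List α → LeafTree α → ℕ → Prop
  | nil (t : LeafTree α) : Serves k t [] t 0
  | cons {t t' t'' : LeafTree α} {x : α} {A : List α} {c c' : ℕ} :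
      Reach k t t' c → Top x t' → Serves k t' A t'' c' → Serves k t (x :: A) t'' (c + c')

theorem Serves.leaves_perm {t t' : LeafTree α} {A : List α} {c : ℕ} (h : Serves k t A t' c) :
    t.leaves.Perm t'.leaves := by
  induction h with
  | nil t => exact .refl _
  | cons h _ _ ih => exact h.leaves_perm.trans ih

theorem Serves.append {t t' t'' : LeafTree α} {A A' : List α} {c c' : ℕ} (h : Serves k t A t' c)
    (h' : Serves k t' A' t'' c') : Serves k t (A ++ A') t'' (c + c') := by
  induction h with
  | nil t => simpa using h'
  | cons h ht _ ih => rw [add_assoc]; exact .cons h ht (ih h')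

/-- Bringing each element to the top separately. -/
theorem Serves.exists_naive (A : List α) (t : LeafTree α) (hA : ∀ x ∈ A, x ∈ t.leaves) :
    ∃ t', Serves k t A t' (22 * t.leaves.length * A.length) := by
  induction A generalizing t with
  | nil => exact ⟨t, .nil t⟩
  | cons x A ih =>
    obtain ⟨t', h, ht⟩ := Reach.bring (k := k) (hA x (by simp))
    obtain ⟨t'', h'⟩ := ih t' fun y hy => h.leaves_perm.subset (hA y (by simp [hy]))
    refine ⟨t'', ?_⟩
    have := Serves.cons h ht h'
    rw [← h.leaves_perm.length_eq] at this
    rwa [List.length_cons, mul_add_one, add_comm]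

end LeafTree

/-! ### In-place radix sort with `k` fingers -/

/-- `ArrayMoves k m f p f' p' c`: an array on the positions below `m`, in which position `i` holds the
item with destination `f i`, is rearranged to `f'` by `c` operations, while the `k` fingers move from
the positions `p` to `p'`.  Positions above `m` stand for unknown locations. -/
inductive ArrayMoves (k m : ℕ) :
    Equiv.Perm ℕ → (Fin k → ℕ) → Equiv.Perm ℕ → (Fin k → ℕ) → ℕ → Prop
  | refl (f : Equiv.Perm ℕ) (p : Fin k → ℕ) : ArrayMoves k m f p f p 0
  | trans {f f' f'' : Equiv.Perm ℕ} {p p' p'' : Fin k → ℕ} {c c' : ℕ} :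
      ArrayMoves k m f p f' p' c → ArrayMoves k m f' p' f'' p'' c' →
      ArrayMoves k m f p f'' p'' (c + c')
  | weaken {f f' : Equiv.Perm ℕ} {p p' : Fin k → ℕ} {c c' : ℕ} :
      ArrayMoves k m f p f' p' c → c ≤ c' → ArrayMoves k m f p f' p' c'
  | right (f : Equiv.Perm ℕ) (p : Fin k → ℕ) (i : Fin k) : p i < m →
      ArrayMoves k m f p f (Function.update p i (p i + 1)) 1
  | left (f : Equiv.Perm ℕ) (p : Fin k → ℕ) (i : Fin k) (q : ℕ) : p i = q + 1 → q < m →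
      ArrayMoves k m f p f (Function.update p i q) 1
  | copy (f : Equiv.Perm ℕ) (p : Fin k → ℕ) (i j : Fin k) : p i ≤ m →
      ArrayMoves k m f p f (Function.update p j (p i)) 2
  | exch (f : Equiv.Perm ℕ) (p : Fin k → ℕ) (i j : Fin k) : p i < m → p j < m →
      ArrayMoves k m f p ((Equiv.swap (p i) (p j)).trans f) p 6

namespace ArrayMoves

variable {k m : ℕ}

theorem right_add (f : Equiv.Perm ℕ) (p : Fin k → ℕ) (i : Fin k) (d : ℕ) (h : p i + d ≤ m) :
    ArrayMoves k m f p f (Function.update p i (p i + d)) d := by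
  induction d with
  | zero => simpa using ArrayMoves.refl f p
  | succ d ih =>
    have := (ih (by omega)).trans (ArrayMoves.right f _ i (by simp; omega))
    simpa [add_assoc] using this

theorem left_sub (f : Equiv.Perm ℕ) (p : Fin k → ℕ) (i : Fin k) (q d : ℕ) (hp : p i = q + d)
    (h : q + d ≤ m) : ArrayMoves k m f p f (Function.update p i q) d := by
  induction d generalizing p with
  | zero =>
    have : Function.update p i q = p := by rw [← show p i = q from hp]; simp
    simpa [this] using ArrayMoves.refl f p
  | succ d ih =>
    have := (ArrayMoves.left f p i (q + d) (by omega) (by omega)).trans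
      (ih _ (by simp) (by omega))
    rw [Function.update_idem] at this
    exact this.weaken (by omega)

/-- Placing fingers at distance `w` from each other. -/
theorem spread (f : Equiv.Perm ℕ) (p : Fin k → ℕ) [NeZero k] {lo s w : ℕ} (hp : p 0 = lo)
    (hm : lo + s ≤ m) (c : ℕ) (hc : c < k) (hcs : c * w < s) :
    ∃ p', ArrayMoves k m f p f p' (c * (w + 2)) ∧ ∀ b : Fin k, b.val ≤ c → p' b = lo + b.val * w := by
  induction c with
  | zero =>
    refine ⟨p, (ArrayMoves.refl f p).weaken (by omega), fun b hb => ?_⟩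
    obtain rfl : b = 0 := by ext; simpa using hb
    simpa using hp
  | succ c ih =>
    rw [add_one_mul] at hcs
    obtain ⟨p', h, hp'⟩ := ih (by omega) (by omega)
    have e := hp' ⟨c, by omega⟩ le_rfl
    simp only at e
    have h1 := ArrayMoves.copy (m := m) f p' ⟨c, by omega⟩ ⟨c + 1, hc⟩ (by omega)
    have h2 := right_add (m := m) f (Function.update p' ⟨c + 1, hc⟩ (p' ⟨c, by omega⟩)) ⟨c + 1, hc⟩ w
      (by rw [Function.update_self]; omega)
    refine ⟨_, ((h.trans h1).trans h2).weaken (le_of_eq (by ring)), fun b hb => ?_⟩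
    by_cases hb' : b = ⟨c + 1, hc⟩
    · subst hb'
      simp [e]; ring
    · have : b.val ≠ c + 1 := fun h => hb' (Fin.ext h)
      simp [hb', hp' b (by omega)]

/-- The array `f` on the segment of length `s` from `lo` is split in blocks of length `w`; the finger
`b` stands in block `b`, and the items of the block to its left belong to the block. -/
structure PartlySplit (f₀ : Equiv.Perm ℕ) (lo s w : ℕ) (f : Equiv.Perm ℕ) (p : Fin k → ℕ) : Prop where
  mapsTo : ∀ i, lo ≤ i → i < lo + s → lo ≤ f i ∧ f i < lo + s
  outside : ∀ i, ¬ (lo ≤ i ∧ i < lo + s) → f i = f₀ i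
  bounds : ∀ b : Fin k, b.val * w < s → lo + b.val * w ≤ p b ∧ p b ≤ lo + (b.val + 1) * w ∧ p b ≤ lo + s
  filled : ∀ b : Fin k, b.val * w < s → ∀ i, lo + b.val * w ≤ i → i < p b → (f i - lo) / w = b.val

/-- The item under an unfinished finger `b` is exchanged into the position of the finger `b'` of its
destination block, and `b'` advances. Only `b'` moves, at cost 6 + 1; `b = b'` is allowed. -/
theorem PartlySplit.step {f₀ f : Equiv.Perm ℕ} {lo s w : ℕ} {p : Fin k → ℕ}
    (h : PartlySplit f₀ lo s w f p) (hw : 0 < w) (hs : s ≤ k * w) (hm : lo + s ≤ m) (b : Fin k)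
    (hb : b.val * w < s) (h1 : p b < lo + (b.val + 1) * w) (h2 : p b < lo + s) :
    ∃ f' p', ArrayMoves k m f p f' p' 7 ∧ PartlySplit f₀ lo s w f' p' ∧ ∃ b' : Fin k,
      b'.val * w < s ∧ p b' < lo + (b'.val + 1) * w ∧ p b' < lo + s ∧
      p' = Function.update p b' (p b' + 1) := by
  have block : ∀ i (a : ℕ), lo + a * w ≤ i → i < lo + (a + 1) * w → (i - lo) / w = a := by
    intro i a h3 h4
    rw [add_one_mul] at h4
    rw [Nat.div_eq_iff hw]
    constructor <;> omega
  have hb1 := h.bounds b hb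
  have hy := h.mapsTo (p b) (by omega) h2
  set y := f (p b) with hy_def
  have hyk : (y - lo) / w < k := by rw [Nat.div_lt_iff_lt_mul hw]; omega
  set b' : Fin k := ⟨(y - lo) / w, hyk⟩ with hb'_def
  have hbw : b'.val * w ≤ y - lo := Nat.div_mul_le_self _ _
  have hbw' : y - lo < (b'.val + 1) * w := by
    rw [add_one_mul]; exact Nat.lt_div_mul_add hw
  have hb's : b'.val * w < s := by omega
  have hb2 := h.bounds b' hb's
  -- Pigeonhole: if block `b'` were already filled, its positions together with `p b` would hold
  -- more items destined for that block than it has positions.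
  have key : p b' < lo + (b'.val + 1) * w ∧ p b' < lo + s := by
    by_contra hcon
    have hne : b ≠ b' := by
      intro e; rw [← e] at hcon; exact hcon ⟨h1, h2⟩
    let R := Finset.Ico (lo + b'.val * w) (p b')
    have hnot : p b ∉ R := by
      intro hR
      rw [Finset.mem_Ico] at hR
      have e1 := block (p b) b hb1.1 h1
      have e2 := block (p b) b' hR.1 (by omega)
      exact hne (Fin.ext (e1.symm.trans e2))
    have hmaps : ∀ i ∈ insert (p b) R, f i ∈ R := by
      intro i hi
      rw [Finset.mem_insert] at hi
      rw [Finset.mem_Ico]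
      rcases hi with rfl | hi
      · omega
      · rw [Finset.mem_Ico] at hi
        have e1 := h.filled b' hb's i hi.1 hi.2
        have e2 := h.mapsTo i (by omega) (by omega)
        have e3 : b'.val * w ≤ f i - lo := by rw [← e1]; exact Nat.div_mul_le_self _ _
        have e4 : f i - lo < (b'.val + 1) * w := by
          rw [← e1, add_one_mul]; exact Nat.lt_div_mul_add hw
        omega
    obtain ⟨i, _, j, _, hij, hf⟩ := Finset.exists_ne_map_eq_of_card_lt_of_maps_to
      (by rw [Finset.card_insert_of_notMem hnot]; omega : R.card < (insert (p b) R).card) hmaps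
    exact hij (f.injective hf)
  refine ⟨_, _, (ArrayMoves.exch f p b b' (by omega) (by omega)).trans
    (ArrayMoves.right _ p b' (by omega)), ?_, b', hb's, key.1, key.2, rfl⟩
  have swap_other : ∀ i, i ≠ p b → i ≠ p b' → f (Equiv.swap (p b) (p b') i) = f i :=
    fun i h3 h4 => by rw [Equiv.swap_apply_of_ne_of_ne h3 h4]
  constructor
  · intro i h3 h4
    simp only [Equiv.trans_apply]
    by_cases e1 : i = p b
    · subst e1; rw [Equiv.swap_apply_left]; exact h.mapsTo _ (by omega) (by omega)
    by_cases e2 : i = p b'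
    · subst e2; rw [Equiv.swap_apply_right]; exact hy
    rw [swap_other i e1 e2]; exact h.mapsTo i h3 h4
  · intro i hi
    simp only [Equiv.trans_apply]
    rw [swap_other i (by omega) (by omega)]; exact h.outside i hi
  · intro a ha
    have := h.bounds a ha
    by_cases e : a = b'
    · subst e; rw [Function.update_self]; omega
    · rw [Function.update_of_ne e]; exact this
  · intro a ha i h3 h4
    simp only [Equiv.trans_apply]
    have hba := h.bounds a ha
    by_cases e2 : i = p b'
    · have e1 := block i b' (by omega) (by omega)
      have e3 : i < lo + (a.val + 1) * w := by
        by_cases e : a = b'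
        · subst e; omega
        · rw [Function.update_of_ne e] at h4; omega
      have e4 := block i a h3 e3
      subst e2
      rw [Equiv.swap_apply_right, ← e4, e1]
    · have h5 : i < p a := by
        by_cases e : a = b'
        · subst e; rw [Function.update_self] at h4; omega
        · rwa [Function.update_of_ne e] at h4
      have e1 : i ≠ p b := by
        intro e1
        have e3 := block i a h3 (by omega)
        have e4 := block i b (by omega) (by omega)
        have : a = b := Fin.ext (e3.symm.trans e4)
        subst this; omega
      rw [swap_other i e1 e2]; exact h.filled a ha i h3 h5

/-- The potential is the number of positions not yet passed by the finger of their block; every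
exchange lowers it. -/
theorem PartlySplit.exists_split {f₀ f : Equiv.Perm ℕ} {lo s w : ℕ} {p : Fin k → ℕ}
    (h : PartlySplit f₀ lo s w f p) (hw : 0 < w) (hs : s ≤ k * w) (hm : lo + s ≤ m) (d : ℕ)
    (hd : ((Finset.Ico lo (lo + s)).filter
      fun i => ∃ b : Fin k, b.val = (i - lo) / w ∧ p b ≤ i).card ≤ d) :
    ∃ f' p', ArrayMoves k m f p f' p' (7 * d) ∧ PartlySplit f₀ lo s w f' p' ∧
      ∀ b : Fin k, b.val * w < s → lo + (b.val + 1) * w ≤ p' b ∨ lo + s ≤ p' b := by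
  induction d generalizing f p with
  | zero =>
    refine ⟨f, p, .refl f p, h, fun b hb => ?_⟩
    by_contra hcon
    have hb1 := h.bounds b hb
    rw [Nat.le_zero, Finset.card_eq_zero, Finset.filter_eq_empty_iff] at hd
    rw [add_one_mul] at hcon
    refine hd (x := p b) (by rw [Finset.mem_Ico]; omega) ⟨b, ?_, le_rfl⟩
    symm
    rw [Nat.div_eq_iff hw]
    constructor <;> omega
  | succ d ih =>
    by_cases hdone : ∀ b : Fin k, b.val * w < s → lo + (b.val + 1) * w ≤ p b ∨ lo + s ≤ p b
    · exact ⟨f, p, (ArrayMoves.refl f p).weaken (by omega), h, hdone⟩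
    push Not at hdone
    obtain ⟨b, hb, h1, h2⟩ := hdone
    obtain ⟨f', p', hM, h', b', h3, h4, h5, rfl⟩ := h.step hw hs hm b hb h1 h2
    have hb' := h.bounds b' h3
    suffices hcard : _ by
      obtain ⟨f'', p'', hM', h'', hd''⟩ := ih h' hcard
      exact ⟨f'', p'', (hM.trans hM').weaken (by omega), h'', hd''⟩
    refine Nat.le_of_lt_succ (lt_of_lt_of_le (Finset.card_lt_card ?_) hd)
    refine Finset.ssubset_iff_of_subset ?_ |>.2 ⟨p b', ?_, ?_⟩
    · intro i hi
      rw [Finset.mem_filter] at hi ⊢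
      obtain ⟨hi, a, ha, hpa⟩ := hi
      refine ⟨hi, a, ha, ?_⟩
      by_cases e : a = b'
      · subst e; rw [Function.update_self] at hpa; omega
      · rwa [Function.update_of_ne e] at hpa
    · rw [Finset.mem_filter, Finset.mem_Ico]
      refine ⟨by omega, b', ?_, le_rfl⟩
      symm
      rw [Nat.div_eq_iff hw]
      rw [add_one_mul] at h4
      constructor <;> omega
    · rw [Finset.mem_filter]
      rintro ⟨_, a, ha, hpa⟩
      have : a = b' := by
        ext
        rw [ha, Nat.div_eq_iff hw]
        rw [add_one_mul] at h4
        constructor <;> omega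
      subst this
      rw [Function.update_self] at hpa
      omega

/-- In-place radix sort. -/
theorem exists_sort [NeZero k] (D : ℕ) (lo s : ℕ) (f : Equiv.Perm ℕ) (p : Fin k → ℕ) (hs : s ≤ k ^ D)
    (hm : lo + s ≤ m) (hp : p 0 = lo)
    (hf : ∀ i, lo ≤ i → i < lo + s → lo ≤ f i ∧ f i < lo + s) :
    ∃ f' p', ArrayMoves k m f p f' p' (20 * s * D) ∧ p' 0 = lo ∧
      (∀ i, lo ≤ i → i < lo + s → f' i = i) ∧ ∀ i, ¬ (lo ≤ i ∧ i < lo + s) → f' i = f i := by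
  induction D generalizing lo s f p with
  | zero =>
    refine ⟨f, p, (ArrayMoves.refl f p).weaken (by omega), hp, fun i h1 h2 => ?_, fun _ _ => rfl⟩
    have := hf i h1 h2
    rw [pow_zero] at hs
    omega
  | succ D ih =>
    rcases Nat.eq_zero_or_pos s with rfl | hs0
    · exact ⟨f, p, (ArrayMoves.refl f p).weaken (by omega), hp, fun i h1 h2 => by omega,
        fun _ _ => rfl⟩
    have hk : 0 < k := Nat.pos_of_neZero k
    -- The blocks collect the items whose destination, relative to `lo`, has a given leading
    -- base-`k` digit.
    obtain ⟨w, hw_def⟩ : ∃ w, w = k ^ D := ⟨_, rfl⟩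
    have hw : 0 < w := hw_def ▸ pow_pos hk D
    have hskw : s ≤ k * w := by rw [hw_def, mul_comm, ← pow_succ]; exact hs
    rw [← hw_def] at ih
    -- place the fingers
    obtain ⟨c, hc⟩ : ∃ c, c = (s - 1) / w := ⟨_, rfl⟩
    have hcw : c * w ≤ s - 1 := hc ▸ Nat.div_mul_le_self _ _
    have hck : c < k := by rw [hc, Nat.div_lt_iff_lt_mul hw]; omega
    have hcs : c ≤ s - 1 := le_trans (Nat.le_mul_of_pos_right c hw) hcw
    obtain ⟨p₁, hM1, hp₁⟩ := spread (m := m) f p (w := w) hp hm c hck (by omega)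
    have hle : ∀ b : ℕ, b * w < s → b ≤ c := fun b hb => by
      rw [hc, Nat.le_div_iff_mul_le hw]; omega
    have hsplit : PartlySplit f lo s w f p₁ := by
      refine ⟨hf, fun _ _ => rfl, fun b hb => ?_, fun b hb i h1 h2 => ?_⟩
      · rw [hp₁ b (hle b hb), add_one_mul]; omega
      · rw [hp₁ b (hle b hb)] at h2; omega
    -- distribute the items
    obtain ⟨f₂, p₂, hM2, h2, hfull⟩ := hsplit.exists_split hw hskw hm s
      ((Finset.card_filter_le _ _).trans (by simp))
    have hb0 := h2.bounds 0 (by simpa using hs0)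
    simp only [Fin.val_zero, zero_mul, zero_add, one_mul, add_zero] at hb0
    have hM3 := left_sub (m := m) f₂ p₂ 0 lo (p₂ 0 - lo) (by omega) (by omega)
    -- sort the blocks
    have blocks : ∀ c ≤ k, ∃ f' p', ArrayMoves k m f₂ (Function.update p₂ 0 lo) f' p'
        (min (c * w) s * (20 * D + 1)) ∧ p' 0 = lo + min (c * w) s ∧
        (∀ i, lo ≤ i → i < lo + min (c * w) s → f' i = i) ∧
        ∀ i, ¬ (lo ≤ i ∧ i < lo + min (c * w) s) → f' i = f₂ i := by
      intro c hc
      induction c with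
      | zero =>
        refine ⟨_, _, (ArrayMoves.refl _ _).weaken (by omega), by simp, fun i h1 h2 => ?_,
          fun _ _ => rfl⟩
        simp at h2; omega
      | succ c ihc =>
        obtain ⟨f₃, p₃, hM, hp3, hid, hout⟩ := ihc (by omega)
        by_cases hcs : s ≤ c * w
        · have e1 : min ((c + 1) * w) s = s := min_eq_right (by rw [add_one_mul]; omega)
          have e2 : min (c * w) s = s := min_eq_right hcs
          rw [e2] at hM hp3 hid hout
          rw [e1]
          exact ⟨f₃, p₃, hM, hp3, hid, hout⟩
        push Not at hcs
        have e2 : min (c * w) s = c * w := min_eq_left hcs.le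
        rw [e2] at hM hp3 hid hout
        obtain ⟨u, hu⟩ : ∃ u, u = min w (s - c * w) := ⟨_, rfl⟩
        have e1 : min ((c + 1) * w) s = c * w + u := by rw [add_one_mul]; omega
        have hbc := h2.bounds ⟨c, by omega⟩ hcs
        have hfc := hfull ⟨c, by omega⟩ hcs
        simp only [add_one_mul] at hbc hfc
        have hpc : p₂ ⟨c, by omega⟩ = lo + c * w + u := by omega
        -- The recursive call asks only for finger 0 at the start of the block; it places the other
        -- fingers that it needs by copying.
        obtain ⟨f₄, p₄, hM4, hp4, hid4, hout4⟩ := ih (lo + c * w) u f₃ p₃ (by omega) (by omega) hp3 (by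
          intro i h3 h4
          rw [hout i (by omega)]
          have e3 := h2.filled ⟨c, by omega⟩ hcs i h3 (by omega)
          have e4 := h2.mapsTo i (by omega) (by omega)
          rw [Nat.div_eq_iff hw] at e3
          simp only at e3
          omega)
        have hM5 := right_add (m := m) f₄ p₄ 0 u (by omega)
        refine ⟨f₄, _, ((hM.trans hM4).trans hM5).weaken ?_, ?_, ?_, ?_⟩
        · rw [e1]
          apply le_of_eq
          ring
        · rw [Function.update_self, e1]; omega
        · intro i h3 h4
          rw [e1] at h4
          by_cases h5 : i < lo + c * w
          · rw [hout4 i (by omega)]; exact hid i h3 h5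
          · exact hid4 i (by omega) (by omega)
        · intro i hi
          rw [e1] at hi
          rw [hout4 i (by omega), hout i (by omega)]
    obtain ⟨f₃, p₃, hM4, hp3, hid, hout⟩ := blocks k le_rfl
    rw [min_eq_right hskw] at hM4 hp3 hid hout
    have hM5 := left_sub (m := m) f₃ p₃ 0 lo s hp3 hm
    refine ⟨f₃, _, ((((hM1.trans hM2).trans hM3).trans hM4).trans hM5).weaken ?_, by simp, hid, ?_⟩
    -- Besides the recursive cost: placing fingers at most `3 * s`, distributing `7 * s`, walking
    -- over the blocks `s`, and two returns of at most `s` each.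
    · have : c * (w + 2) = c * w + 2 * c := by ring
      have e2 : 20 * s * (D + 1) = s * (20 * D + 1) + 19 * s := by ring
      omega
    · intro i hi
      rw [hout i hi, h2.outside i hi]

end ArrayMoves

/-! ### Pointer trees that represent abstract trees -/

namespace PointerTree

variable {V : Type*} {n : ℕ}

/-- Every node is the child of at most one node, on at most one side. -/
def UniqueParent (T : PointerTree V n) : Prop :=
  ∀ u s u' s' v, T.child u s = some v → T.child u' s' = some v → u = u' ∧ s = s'

/-- `v` is the root of a subtree of `T` with node set `S` that has the shape of `t`. -/
def Rep (T : PointerTree V n) (v : V) : LeafTree (Fin n) → Set V → Prop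
  | .leaf x, S => v = T.node x ∧ (∀ s, T.child v s = none) ∧ S = {v}
  | .node l r, S => ∃ a b A B, T.child v .left = some a ∧ T.child v .right = some b ∧
      T.Rep a l A ∧ T.Rep b r B ∧ v ∉ A ∧ v ∉ B ∧ Disjoint A B ∧ S = insert v (A ∪ B)

theorem Rep.mem_root {T : PointerTree V n} {v : V} {t : LeafTree (Fin n)} {S : Set V}
    (h : T.Rep v t S) : v ∈ S := by
  cases t with
  | leaf x => obtain ⟨_, _, rfl⟩ := h; rfl
  | node l r => obtain ⟨a, b, A, B, _, _, _, _, _, _, _, rfl⟩ := h; exact Set.mem_insert _ _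

/-- No pointer leaves `S` and none inside returns to the root. This yields the disjointness needed
for swaps and, for `S = Set.univ`, that the root has no parent. -/
theorem Rep.closed {T : PointerTree V n} {v : V} {t : LeafTree (Fin n)} {S : Set V}
    (h : T.Rep v t S) {u w : V} {s : Side} (hu : u ∈ S) (hw : T.child u s = some w) :
    w ∈ S ∧ w ≠ v := by
  induction t generalizing v S with
  | leaf x =>
    obtain ⟨_, h2, rfl⟩ := h
    obtain rfl : u = v := hu
    rw [h2] at hw
    cases hw
  | node l r hl hr =>
    obtain ⟨a, b, A, B, h1, h2, h3, h4, h5, h6, _, rfl⟩ := h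
    have hA : ∀ w ∈ A, w ∈ insert v (A ∪ B) ∧ w ≠ v :=
      fun w hw => ⟨.inr (.inl hw), fun e => h5 (e ▸ hw)⟩
    have hB : ∀ w ∈ B, w ∈ insert v (A ∪ B) ∧ w ≠ v :=
      fun w hw => ⟨.inr (.inr hw), fun e => h6 (e ▸ hw)⟩
    rcases hu with rfl | hu | hu
    · cases s with
      | left => rw [h1] at hw; cases hw; exact hA _ h3.mem_root
      | right => rw [h2] at hw; cases hw; exact hB _ h4.mem_root
    · exact hA _ (hl h3 hu).1
    · exact hB _ (hr h4 hu).1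

theorem Rep.congr {T T' : PointerTree V n} {v : V} {t : LeafTree (Fin n)} {S : Set V}
    (h : T.Rep v t S) (hnode : T'.node = T.node) (hc : ∀ u ∈ S, T'.child u = T.child u) :
    T'.Rep v t S := by
  induction t generalizing v S with
  | leaf x =>
    obtain ⟨h1, h2, rfl⟩ := h
    exact ⟨by rw [hnode]; exact h1, fun s => by rw [hc v rfl]; exact h2 s, rfl⟩
  | node l r hl hr =>
    obtain ⟨a, b, A, B, h1, h2, h3, h4, h5, h6, h7, rfl⟩ := h
    have hv := hc v (.inl rfl)
    exact ⟨a, b, A, B, by rw [hv]; exact h1, by rw [hv]; exact h2,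
      hl h3 fun u hu => hc u (.inr (.inl hu)), hr h4 fun u hu => hc u (.inr (.inr hu)),
      h5, h6, h7, rfl⟩

theorem Rep.inSubtree_mem {T : PointerTree V n} {v : V} {t : LeafTree (Fin n)} {S : Set V}
    (h : T.Rep v t S) {d : V} (hd : T.InSubtree v d) : d ∈ S := by
  induction hd with
  | refl => exact h.mem_root
  | tail _ hp ih =>
    obtain ⟨s, hs⟩ := hp
    exact (h.closed ih hs).1

/-- A swap composes all pointers with a permutation of the nodes, which keeps distinct pointers
distinct. -/
theorem UniqueParent.swapSubtrees {T : PointerTree V n} (h : T.UniqueParent) (b d : V) :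
    (T.swapSubtrees b d).UniqueParent := by
  classical
  intro u s u' s' v h1 h2
  simp only [PointerTree.swapSubtrees, Option.map_eq_some_iff] at h1 h2
  obtain ⟨w, hw, rfl⟩ := h1
  obtain ⟨w', hw', e⟩ := h2
  obtain rfl := (Equiv.injective _) e
  exact h u s u' s' _ hw hw'

theorem swapSubtrees_child {T : PointerTree V n} {b d u w : V} {s : Side}
    (h : T.child u s = some w) (h1 : w ≠ b) (h2 : w ≠ d) :
    (T.swapSubtrees b d).child u s = some w := by
  classical
  simp [swapSubtrees, h, Equiv.swap_apply_of_ne_of_ne h1 h2]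

theorem swapSubtrees_child_left {T : PointerTree V n} {b u : V} (d : V) {s : Side}
    (h : T.child u s = some b) : (T.swapSubtrees b d).child u s = some d := by
  simp [swapSubtrees, h]

theorem swapSubtrees_child_right {T : PointerTree V n} {d u : V} (b : V) {s : Side}
    (h : T.child u s = some d) : (T.swapSubtrees b d).child u s = some b := by
  simp [swapSubtrees, h]

theorem UniqueParent.swapSubtrees_child_eq {T : PointerTree V n} (h : T.UniqueParent)
    {b d p p' : V} {s s' : Side} (hb : T.child p s = some b) (hd : T.child p' s' = some d) {u : V}
    (hp : u ≠ p) (hp' : u ≠ p') : (T.swapSubtrees b d).child u = T.child u := by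
  funext r
  rcases hw : T.child u r with _ | w
  · simp [PointerTree.swapSubtrees, hw]
  · refine swapSubtrees_child hw ?_ ?_
    · rintro rfl; exact hp (h _ _ _ _ _ hw hb).1
    · rintro rfl; exact hp' (h _ _ _ _ _ hw hd).1

end PointerTree

/-! ### Realising the local moves by finger operations -/

namespace FingerConfig

open PointerTree

variable {V : Type*} {n k : ℕ}

/-- `Steps c c' q`: at most `q` operations lead from `c` to `c'`. -/
inductive Steps : FingerConfig V n k → FingerConfig V n k → ℕ → Prop
  | refl (c : FingerConfig V n k) : Steps c c 0
  | single {c c' : FingerConfig V n k} : Step c c' → Steps c c' 1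
  | trans {c c' c'' : FingerConfig V n k} {q q' : ℕ} :
      Steps c c' q → Steps c' c'' q' → Steps c c'' (q + q')
  | weaken {c c' : FingerConfig V n k} {q q' : ℕ} : Steps c c' q → q ≤ q' → Steps c c' q'

theorem Steps.run {c c' : FingerConfig V n k} {q : ℕ} (h : Steps c c' q) {x : Fin n} {r : ℕ}
    {T : PointerTree V n} (hr : Run c' x r T) : ∃ q' ≤ q + r, Run c x q' T := by
  induction h generalizing r with
  | refl c => exact ⟨r, by omega, hr⟩
  | single h => exact ⟨r + 1, by omega, .step _ _ _ _ _ h hr⟩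
  | trans _ _ h h' =>
    obtain ⟨q1, h1, h2⟩ := h' hr
    obtain ⟨q2, h3, h4⟩ := h h2
    exact ⟨q2, by omega, h4⟩
  | weaken _ hq h =>
    obtain ⟨q1, h1, h2⟩ := h hr
    exact ⟨q1, by omega, h2⟩

/-- Redirecting finger `i` to a child `b`, saving the location of `b`, and going back. -/
theorem Steps.save_child (c : FingerConfig V n k) (i : Fin k) {s : Side} {b : V}
    (h : c.tree.child (c.finger i) s = some b) : Steps c { c with temp := some b } 3 := by
  have h1 := Steps.single (Step.down c i s b h)
  have h2 := Steps.single (Step.save { c with finger := Function.update c.finger i b } i)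
  have h3 := Steps.single (Step.up
    { c with finger := Function.update c.finger i b, temp := some b } i (c.finger i)
    ⟨s, by simpa using h⟩)
  simp only [Function.update_self, Function.update_idem, Function.update_eq_self] at h2 h3
  exact (h1.trans h2).trans h3

/-- A configuration that differs from `c` only inside the subtree with node set `S`. -/
structure LocalChange [NeZero k] (c c' : FingerConfig V n k) (S : Set V) : Prop where
  finger : c'.finger 0 = c.finger 0
  unique : c'.tree.UniqueParent
  root : c'.tree.root = c.tree.root
  node : c'.tree.node = c.tree.node
  outside : ∀ u ∉ S, c'.tree.child u = c.tree.child u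

/-- The subtree of shape `t` at the main finger can be given the shape `t'` in `q` operations. -/
def Realizes (k n : ℕ) [NeZero k] (V : Type*) (t t' : LeafTree (Fin n)) (q : ℕ) : Prop :=
  ∀ (c : FingerConfig V n k) (S : Set V), c.tree.UniqueParent → c.tree.Rep (c.finger 0) t S →
    ∃ c', Steps c c' q ∧ LocalChange c c' S ∧ c'.tree.Rep (c.finger 0) t' S

variable [NeZero k]

theorem Realizes.refl (t : LeafTree (Fin n)) : Realizes k n V t t 0 :=
  fun c _ hU hR => ⟨c, .refl c, ⟨rfl, hU, rfl, rfl, fun _ _ => rfl⟩, hR⟩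

theorem Realizes.trans {t t' t'' : LeafTree (Fin n)} {q q' : ℕ} (h : Realizes k n V t t' q)
    (h' : Realizes k n V t' t'' q') : Realizes k n V t t'' (q + q') := by
  intro c S hU hR
  obtain ⟨c1, h1, l1, r1⟩ := h c S hU hR
  obtain ⟨c2, h2, l2, r2⟩ := h' c1 S l1.unique (by rw [l1.finger]; exact r1)
  exact ⟨c2, h1.trans h2, ⟨l2.finger.trans l1.finger, l2.unique, l2.root.trans l1.root,
    l2.node.trans l1.node, fun u hu => (l2.outside u hu).trans (l1.outside u hu)⟩,
    by rw [← l1.finger]; exact r2⟩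

theorem Realizes.weaken {t t' : LeafTree (Fin n)} {q q' : ℕ} (h : Realizes k n V t t' q)
    (hq : q ≤ q') : Realizes k n V t t' q' := by
  intro c S hU hR
  obtain ⟨c1, h1, l1, r1⟩ := h c S hU hR
  exact ⟨c1, h1.weaken hq, l1, r1⟩

theorem realizes_child {t t' : LeafTree (Fin n)} {q : ℕ} (h : Realizes k n V t t' q)
    (c : FingerConfig V n k) (hU : c.tree.UniqueParent) {s : Side} {a : V} {A : Set V}
    (ha : c.tree.child (c.finger 0) s = some a) (hA : c.tree.Rep a t A) (hv : c.finger 0 ∉ A) :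
    ∃ c', Steps c c' (q + 2) ∧ LocalChange c c' A ∧ c'.tree.Rep a t' A := by
  have h1 := Steps.single (Step.down c 0 s a ha)
  obtain ⟨c1, h2, l1, r1⟩ := h { c with finger := Function.update c.finger 0 a } A hU (by simpa using hA)
  simp only [Function.update_self] at r1
  have e : c1.finger 0 = a := by simpa using l1.finger
  have h3 := Steps.single (Step.up c1 0 (c.finger 0) ⟨s, by rw [l1.outside _ hv, e]; exact ha⟩)
  exact ⟨_, ((h1.trans h2).trans h3).weaken (by omega), ⟨by simp, l1.unique, l1.root, l1.node,
    l1.outside⟩, r1⟩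

theorem Realizes.left {l l' : LeafTree (Fin n)} {q : ℕ} (h : Realizes k n V l l' q)
    (r : LeafTree (Fin n)) : Realizes k n V (.node l r) (.node l' r) (q + 2) := by
  intro c S hU hR
  obtain ⟨a, b, A, B, h1, h2, h3, h4, h5, h6, h7, rfl⟩ := hR
  obtain ⟨c1, hs, l1, r1⟩ := realizes_child h c hU h1 h3 h5
  refine ⟨c1, hs, ⟨l1.finger, l1.unique, l1.root, l1.node, fun u hu => l1.outside u fun hA =>
    hu (.inr (.inl hA))⟩, a, b, A, B, ?_, ?_, r1, ?_, h5, h6, h7, rfl⟩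
  · rw [l1.outside _ h5]; exact h1
  · rw [l1.outside _ h5]; exact h2
  · exact h4.congr l1.node fun u hu => l1.outside u fun hA => Set.disjoint_left.1 h7 hA hu

theorem Realizes.right {r r' : LeafTree (Fin n)} {q : ℕ} (h : Realizes k n V r r' q)
    (l : LeafTree (Fin n)) : Realizes k n V (.node l r) (.node l r') (q + 2) := by
  intro c S hU hR
  obtain ⟨a, b, A, B, h1, h2, h3, h4, h5, h6, h7, rfl⟩ := hR
  obtain ⟨c1, hs, l1, r1⟩ := realizes_child h c hU h2 h4 h6
  refine ⟨c1, hs, ⟨l1.finger, l1.unique, l1.root, l1.node, fun u hu => l1.outside u fun hB =>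
    hu (.inr (.inr hB))⟩, a, b, A, B, ?_, ?_, ?_, r1, h5, h6, h7, rfl⟩
  · rw [l1.outside _ h6]; exact h1
  · rw [l1.outside _ h6]; exact h2
  · exact h3.congr l1.node fun u hu => l1.outside u fun hB => Set.disjoint_left.1 h7 hu hB

theorem Realizes.flip (l r : LeafTree (Fin n)) : Realizes k n V (.node l r) (.node r l) 4 := by
  intro c S hU hR
  obtain ⟨a, b, A, B, h1, h2, h3, h4, h5, h6, h7, rfl⟩ := hR
  have hs := Steps.save_child c 0 h1
  have hab : b ∉ A := fun h => Set.disjoint_left.1 h7 h h4.mem_root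
  have hba : a ∉ B := fun h => Set.disjoint_left.1 h7 h3.mem_root h
  have h8 := Steps.single (Step.swap { c with temp := some a } 0 .right a b rfl h2
    (fun h => hab (h3.inSubtree_mem h)) (fun h => hba (h4.inSubtree_mem h)))
  have heq : ∀ u, u ≠ c.finger 0 → (c.tree.swapSubtrees a b).child u = c.tree.child u :=
    fun u hu => hU.swapSubtrees_child_eq h1 h2 hu hu
  refine ⟨_, hs.trans h8, ⟨rfl, hU.swapSubtrees _ _, rfl, rfl, fun u hu => heq u fun e =>
    hu (.inl e)⟩, b, a, B, A, swapSubtrees_child_left _ h1, swapSubtrees_child_right _ h2, ?_, ?_,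
    h6, h5, h7.symm, by rw [Set.union_comm]⟩
  · exact h4.congr rfl fun u hu => heq u fun e => h6 (e ▸ hu)
  · exact h3.congr rfl fun u hu => heq u fun e => h5 (e ▸ hu)

/-- Descend to the left child, save its left child, return, and swap it with the right child of the
root: 1 + 3 + 1 + 1. -/
theorem Realizes.exch (x y z : LeafTree (Fin n)) :
    Realizes k n V (.node (.node x y) z) (.node (.node z y) x) 6 := by
  intro c S hU hR
  obtain ⟨m, d, M, D, h1, h2, ⟨a, b, A, B, g1, g2, g3, g4, g5, g6, g7, rfl⟩, h4, h5, h6, h7, rfl⟩ := hR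
  have hvm : c.finger 0 ≠ m := fun e => h5 (.inl e)
  have hvA : c.finger 0 ∉ A := fun e => h5 (.inr (.inl e))
  have hvB : c.finger 0 ∉ B := fun e => h5 (.inr (.inr e))
  have hmD : m ∉ D := fun e => Set.disjoint_left.1 h7 (.inl rfl) e
  have hAD : Disjoint A D := Set.disjoint_left.2 fun u hu e => Set.disjoint_left.1 h7 (.inr (.inl hu)) e
  have hBD : Disjoint B D := Set.disjoint_left.2 fun u hu e => Set.disjoint_left.1 h7 (.inr (.inr hu)) e
  have hdA : d ∉ A := fun h => Set.disjoint_left.1 hAD h h4.mem_root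
  have haD : a ∉ D := fun h => Set.disjoint_left.1 hAD g3.mem_root h
  have s1 := Steps.single (Step.down c 0 .left m h1)
  have s2 := Steps.save_child { c with finger := Function.update c.finger 0 m } 0 (s := .left) (b := a)
    (by simpa using g1)
  have s3 := Steps.single (Step.up
    { c with finger := Function.update c.finger 0 m, temp := some a } 0 (c.finger 0)
    ⟨.left, by simpa using h1⟩)
  simp only [Function.update_idem, Function.update_eq_self] at s3
  have s4 := Steps.single (Step.swap { c with temp := some a } 0 .right a d rfl h2
    (fun h => hdA (g3.inSubtree_mem h)) (fun h => haD (h4.inSubtree_mem h)))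
  have heq : ∀ u, u ≠ m → u ≠ c.finger 0 → (c.tree.swapSubtrees a d).child u = c.tree.child u :=
    fun u hu hu' => hU.swapSubtrees_child_eq g1 h2 hu hu'
  refine ⟨_, (((s1.trans s2).trans s3).trans s4), ⟨rfl, hU.swapSubtrees _ _, rfl, rfl,
    fun u hu => heq u (fun e => hu (.inr (.inl (.inl e)))) (fun e => hu (.inl e))⟩,
    m, a, insert m (D ∪ B), A, ?_, swapSubtrees_child_right _ h2,
    ⟨d, b, D, B, swapSubtrees_child_left _ g1, ?_, ?_, ?_, hmD, g6, hBD.symm, rfl⟩, ?_, ?_, hvA, ?_, ?_⟩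
  · exact swapSubtrees_child h1 (fun e => g5 (e ▸ g3.mem_root)) (fun e => hmD (e ▸ h4.mem_root))
  · exact swapSubtrees_child g2 (fun e => Set.disjoint_left.1 g7 g3.mem_root (e ▸ g4.mem_root))
      (fun e => Set.disjoint_left.1 hBD g4.mem_root (e ▸ h4.mem_root))
  · exact h4.congr rfl fun u hu => heq u (fun e => hmD (e ▸ hu)) fun e => h6 (e ▸ hu)
  · exact g4.congr rfl fun u hu => heq u (fun e => g6 (e ▸ hu)) fun e => hvB (e ▸ hu)
  · exact g3.congr rfl fun u hu => heq u (fun e => g5 (e ▸ hu)) fun e => hvA (e ▸ hu)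
  · rintro (e | e | e)
    · exact hvm e
    · exact h6 e
    · exact hvB e
  · rw [Set.disjoint_left]
    rintro u (rfl | hu | hu) hA
    · exact g5 hA
    · exact Set.disjoint_left.1 hAD hA hu
    · exact Set.disjoint_left.1 g7 hA hu
  · ext u
    simp only [Set.mem_insert_iff, Set.mem_union]
    tauto

end FingerConfig

/-! ### Sorting along the spine of a caterpillar -/

/-- Entries may repeat, so destinations must be chosen: `f` sends a position in `L` to one in `L'`.
Acting on all of `ℕ` avoids bounds in its type. -/
theorem List.Perm.exists_natPerm {α : Type*} {L L' : List α} (h : L.Perm L') :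
    ∃ f : Equiv.Perm ℕ, ∀ i, L'[f i]? = L[i]? := by
  induction h with
  | nil => exact ⟨Equiv.refl _, fun i => rfl⟩
  | cons x _ ih =>
    obtain ⟨f, hf⟩ := ih
    refine ⟨⟨fun i => i.casesOn 0 fun j => f j + 1, fun i => i.casesOn 0 fun j => f.symm j + 1,
      fun i => by cases i <;> simp, fun i => by cases i <;> simp⟩, fun i => ?_⟩
    cases i with
    | zero => rfl
    | succ i => simpa using hf i
  | swap x y l =>
    refine ⟨Equiv.swap 0 1, fun i => ?_⟩
    match i with
    | 0 => simp
    | 1 => simp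
    | i + 2 => rw [Equiv.swap_apply_of_ne_of_ne (by omega) (by omega)]; simp
  | trans _ _ ih ih' =>
    obtain ⟨f, hf⟩ := ih
    obtain ⟨g, hg⟩ := ih'
    exact ⟨f.trans g, fun i => by rw [Equiv.trans_apply, hg, hf]⟩

namespace PointerTree

variable {V : Type*} {n : ℕ}

/-- Nodes `s 0, …, s m`, of which the last carries the node set `E`, and nodes `a 0, …, a (m - 1)`
carrying node sets `A i`, where everything is disjoint. -/
structure SpineSets (m : ℕ) (s : ℕ → V) (A : ℕ → Set V) (E : Set V) : Prop where
  notMem : ∀ i j, i < m → j < m → s i ∉ A j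
  inj : ∀ i j, i < m → j < m → s i = s j → i = j
  disjoint : ∀ i j, i < m → j < m → i ≠ j → Disjoint (A i) (A j)
  notMem_end : ∀ i, i < m → s i ∉ E
  disjoint_end : ∀ i, i < m → Disjoint (A i) E

/-- All nodes of a spine. -/
def spineUnion (m : ℕ) (s : ℕ → V) (A : ℕ → Set V) (E : Set V) : Set V :=
  {u | (∃ i < m, u = s i ∨ u ∈ A i) ∨ u ∈ E}

theorem spineUnion_succ (m : ℕ) (s : ℕ → V) (A : ℕ → Set V) (E : Set V) :
    spineUnion (m + 1) s A E =
      insert (s 0) (A 0 ∪ spineUnion m (fun i => s (i + 1)) (fun i => A (i + 1)) E) := by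
  ext u
  simp only [spineUnion, Set.mem_insert_iff, Set.mem_union, Set.mem_ofPred_eq]
  constructor
  · rintro (⟨_ | i, hi, h⟩ | h)
    · tauto
    · exact .inr (.inr (.inl ⟨i, by omega, h⟩))
    · tauto
  · rintro (h | h | ⟨i, hi, h⟩ | h)
    · exact .inl ⟨0, by omega, .inl h⟩
    · exact .inl ⟨0, by omega, .inr h⟩
    · exact .inl ⟨i + 1, by omega, h⟩
    · exact .inr h

theorem SpineSets.rep {T : PointerTree V n} {L : List (LeafTree (Fin n))} {e : LeafTree (Fin n)}
    {s a : ℕ → V} {A : ℕ → Set V} {E : Set V} (h : SpineSets L.length s A E)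
    (hl : ∀ i, i < L.length → T.child (s i) .left = some (a i))
    (hr : ∀ i, i < L.length → T.child (s i) .right = some (s (i + 1)))
    (hA : ∀ i (hi : i < L.length), T.Rep (a i) L[i] (A i)) (hE : T.Rep (s L.length) e E) :
    T.Rep (s 0) (LeafTree.comb L e) (spineUnion L.length s A E) := by
  induction L generalizing s a A with
  | nil =>
    have : spineUnion 0 s A E = E := by ext; simp [spineUnion]
    simpa [this] using hE
  | cons x L ih =>
    simp only [List.length_cons] at h hl hr hA hE
    have ih' := ih (s := fun i => s (i + 1)) (a := fun i => a (i + 1)) (A := fun i => A (i + 1))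
      ⟨fun i j hi hj => h.notMem _ _ (by omega) (by omega),
        fun i j hi hj e => by simpa using h.inj _ _ (by omega) (by omega) e,
        fun i j hi hj e => h.disjoint _ _ (by omega) (by omega) (by omega),
        fun i hi => h.notMem_end _ (by omega), fun i hi => h.disjoint_end _ (by omega)⟩
      (fun i hi => hl _ (by omega)) (fun i hi => hr _ (by omega))
      (fun i hi => hA (i + 1) (by omega)) hE
    refine ⟨a 0, s 1, A 0, _, hl 0 (by omega), hr 0 (by omega), hA 0 (by omega), ih',
      h.notMem 0 0 (by omega) (by omega), ?_, ?_, by rw [List.length_cons, spineUnion_succ]⟩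
    · rintro (⟨i, hi, e | e⟩ | e)
      · have := h.inj 0 (i + 1) (by omega) (by omega) e; omega
      · exact h.notMem 0 (i + 1) (by omega) (by omega) e
      · exact h.notMem_end 0 (by omega) e
    · rw [Set.disjoint_left]
      rintro u hu (⟨i, hi, rfl | e⟩ | e)
      · exact h.notMem (i + 1) 0 (by omega) (by omega) hu
      · exact Set.disjoint_left.1 (h.disjoint 0 (i + 1) (by omega) (by omega) (by omega)) hu e
      · exact Set.disjoint_left.1 (h.disjoint_end 0 (by omega)) hu e

theorem Rep.exists_spine {T : PointerTree V n} {L : List (LeafTree (Fin n))}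
    {e : LeafTree (Fin n)} {v : V} {S : Set V} (h : T.Rep v (LeafTree.comb L e) S) :
    ∃ (s a : ℕ → V) (A : ℕ → Set V) (E : Set V), s 0 = v ∧ SpineSets L.length s A E ∧
      (∀ i, i < L.length → T.child (s i) .left = some (a i)) ∧
      (∀ i, i < L.length → T.child (s i) .right = some (s (i + 1))) ∧
      (∀ i (hi : i < L.length), T.Rep (a i) L[i] (A i)) ∧ T.Rep (s L.length) e E ∧
      S = spineUnion L.length s A E := by
  induction L generalizing v S with
  | nil =>
    refine ⟨fun _ => v, fun _ => v, fun _ => ∅, S, rfl, ⟨?_, ?_, ?_, ?_, ?_⟩, ?_, ?_, ?_, h, ?_⟩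
    any_goals simp
    ext; simp [spineUnion]
  | cons x L ih =>
    obtain ⟨a, b, A, B, h1, h2, h3, h4, h5, h6, h7, rfl⟩ := h
    obtain ⟨s', a', A', E, rfl, g1, g2, g3, g4, g5, rfl⟩ := ih h4
    have m1 : ∀ i, i < L.length → s' i ∈ spineUnion L.length s' A' E :=
      fun i hi => .inl ⟨i, hi, .inl rfl⟩
    have m2 : ∀ i, i < L.length → ∀ u ∈ A' i, u ∈ spineUnion L.length s' A' E :=
      fun i hi u hu => .inl ⟨i, hi, .inr hu⟩
    have m3 : ∀ u ∈ E, u ∈ spineUnion L.length s' A' E := fun u hu => .inr hu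
    refine ⟨fun i => i.casesOn v s', fun i => i.casesOn a a', fun i => i.casesOn A A', E, rfl,
      ⟨?_, ?_, ?_, ?_, ?_⟩, ?_, ?_, ?_, g5, ?_⟩
    · rintro (_ | i) (_ | j) hi hj <;> simp only [List.length_cons] at hi hj
      · exact h5
      · exact fun e => h6 (m2 j (by omega) _ e)
      · exact fun e => Set.disjoint_left.1 h7 e (m1 i (by omega))
      · exact g1.notMem i j (by omega) (by omega)
    · rintro (_ | i) (_ | j) hi hj e <;> simp only [List.length_cons] at hi hj e
      · rfl
      · exact absurd (m1 j (by omega)) (e ▸ h6)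
      · exact absurd (m1 i (by omega)) (e ▸ h6)
      · rw [g1.inj i j (by omega) (by omega) e]
    · rintro (_ | i) (_ | j) hi hj e <;> simp only [List.length_cons] at hi hj
      · exact absurd rfl e
      · exact h7.mono_right (m2 j (by omega))
      · exact (h7.mono_right (m2 i (by omega))).symm
      · exact g1.disjoint i j (by omega) (by omega) (by omega)
    · rintro (_ | i) hi <;> simp only [List.length_cons] at hi
      · exact fun e => h6 (m3 _ e)
      · exact g1.notMem_end i (by omega)
    · rintro (_ | i) hi <;> simp only [List.length_cons] at hi
      · exact h7.mono_right m3
      · exact g1.disjoint_end i (by omega)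
    · rintro (_ | i) hi <;> simp only [List.length_cons] at hi
      · exact h1
      · exact g2 i (by omega)
    · rintro (_ | i) hi <;> simp only [List.length_cons] at hi
      · exact h2
      · exact g3 i (by omega)
    · rintro (_ | i) hi
      · exact h3
      · exact g4 i (by simpa using hi)
    · exact (spineUnion_succ L.length (fun i => (Nat.casesOn i v s' : V))
        (fun i => (Nat.casesOn i A A' : Set V)) E).symm

end PointerTree

namespace FingerConfig

open PointerTree

variable {V : Type*} {n k : ℕ}

/-- The spine with nodes `s` in the configuration `c` carries at position `i` the subtree at `a (f i)`,
the fingers stand at the positions `p`, and the rest of the tree is as in `c₀`. -/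
structure OnSpine (c₀ : FingerConfig V n k) (m : ℕ) (s a : ℕ → V) (f : Equiv.Perm ℕ)
    (p : Fin k → ℕ) (c : FingerConfig V n k) : Prop where
  finger : ∀ i, p i ≤ m → c.finger i = s (p i)
  unique : c.tree.UniqueParent
  root : c.tree.root = c₀.tree.root
  node : c.tree.node = c₀.tree.node
  left : ∀ i, i < m → c.tree.child (s i) .left = some (a (f i))
  right : ∀ i, i < m → c.tree.child (s i) .right = some (s (i + 1))
  outside : ∀ u, (∀ i, i < m → u ≠ s i) → c.tree.child u = c₀.tree.child u
  lt : ∀ i, i < m → f i < m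

theorem OnSpine.move {c₀ c : FingerConfig V n k} {m : ℕ} {s a : ℕ → V} {f : Equiv.Perm ℕ}
    {p : Fin k → ℕ} (h : OnSpine c₀ m s a f p c) (i : Fin k) (q : ℕ) :
    OnSpine c₀ m s a f (Function.update p i q)
      { c with finger := Function.update c.finger i (s q) } :=
  { h with
    finger := fun j hj => by
      by_cases e : j = i
      · subst e; simp
      · simp only [Function.update_of_ne e] at hj ⊢; exact h.finger j hj }

theorem OnSpine.exch {c₀ c : FingerConfig V n k} {m : ℕ} {s a : ℕ → V} {f : Equiv.Perm ℕ}
    {p : Fin k → ℕ} {t : ℕ → LeafTree (Fin n)} {A : ℕ → Set V} {E : Set V}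
    (hA : SpineSets m s A E) (hR : ∀ d < m, c₀.tree.Rep (a d) (t d) (A d))
    (h : OnSpine c₀ m s a f p c) (i j : Fin k) (hi : p i < m) (hj : p j < m) (hij : p i ≠ p j) :
    ∃ c', Steps c c' 4 ∧ OnSpine c₀ m s a ((Equiv.swap (p i) (p j)).trans f) p c' := by
  have hfi := h.finger i hi.le
  have hfj := h.finger j hj.le
  have hli := h.left _ hi
  have hlj := h.left _ hj
  have hR' : ∀ d < m, c.tree.Rep (a d) (t d) (A d) := fun d hd =>
    (hR d hd).congr h.node fun u hu => h.outside u fun i hi e => hA.notMem i d hi hd (e ▸ hu)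
  have hmem : ∀ d < m, ∀ d' < m, d ≠ d' → a d' ∉ A d := fun d hd d' hd' e h' =>
    Set.disjoint_left.1 (hA.disjoint d d' hd hd' e) h' (hR' d' hd').mem_root
  have hne : f (p i) ≠ f (p j) := fun e => hij (f.injective e)
  have hli' := h.lt _ hi
  have hlj' := h.lt _ hj
  have s1 := Steps.save_child c j (by rw [hfj]; exact hlj)
  have s2 := Steps.single (Step.swap { c with temp := some (a (f (p j))) } i .left _ (a (f (p i)))
    rfl (by simpa [hfi] using hli)
    (fun h' => hmem _ hlj' _ hli' hne.symm ((hR' _ hlj').inSubtree_mem h'))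
    (fun h' => hmem _ hli' _ hlj' hne ((hR' _ hli').inSubtree_mem h')))
  refine ⟨_, s1.trans s2, h.finger, h.unique.swapSubtrees _ _, h.root, h.node, fun q hq => ?_,
    fun q hq => ?_, fun u hu => ?_, fun q hq => ?_⟩
  · simp only [Equiv.trans_apply]
    by_cases e1 : q = p i
    · subst e1; rw [Equiv.swap_apply_left]; exact swapSubtrees_child_right _ hli
    by_cases e2 : q = p j
    · subst e2; rw [Equiv.swap_apply_right]; exact swapSubtrees_child_left _ hlj
    rw [Equiv.swap_apply_of_ne_of_ne e1 e2]
    have hq' := h.lt q hq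
    refine swapSubtrees_child (h.left q hq) ?_ ?_
    · exact fun e => hmem (f q) hq' _ hlj' (fun e' => e2 (f.injective e')) (e ▸ (hR' _ hq').mem_root)
    · exact fun e => hmem (f q) hq' _ hli' (fun e' => e1 (f.injective e')) (e ▸ (hR' _ hq').mem_root)
  -- Spine successors are right children and the hanging subtrees are left children, so unique
  -- parents keep them apart.
  · have key : ∀ r, r < m → s (q + 1) ≠ a (f r) := by
      intro r hr e
      have := h.unique _ _ _ _ _ (h.right q hq) (by rw [e]; exact h.left r hr)
      cases this.2
    exact swapSubtrees_child (h.right q hq) (key _ hj) (key _ hi)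
  · rw [← h.outside u hu]
    exact h.unique.swapSubtrees_child_eq hlj hli (hu _ hj) (hu _ hi)
  · simp only [Equiv.trans_apply]
    by_cases e1 : q = p i
    · subst e1; rw [Equiv.swap_apply_left]; exact hlj'
    by_cases e2 : q = p j
    · subst e2; rw [Equiv.swap_apply_right]; exact hli'
    rw [Equiv.swap_apply_of_ne_of_ne e1 e2]; exact h.lt q hq

theorem OnSpine.arrayMoves {c₀ c : FingerConfig V n k} {m : ℕ} {s a : ℕ → V}
    {f f' : Equiv.Perm ℕ} {p p' : Fin k → ℕ} {t : ℕ → LeafTree (Fin n)} {A : ℕ → Set V} {E : Set V}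
    (hA : SpineSets m s A E) (hR : ∀ d < m, c₀.tree.Rep (a d) (t d) (A d)) {q : ℕ}
    (hM : ArrayMoves k m f p f' p' q) (h : OnSpine c₀ m s a f p c) :
    ∃ c', Steps c c' q ∧ OnSpine c₀ m s a f' p' c' := by
  induction hM generalizing c with
  | refl f p => exact ⟨c, .refl c, h⟩
  | trans _ _ ih ih' =>
    obtain ⟨c1, h1, h2⟩ := ih h
    obtain ⟨c2, h3, h4⟩ := ih' h2
    exact ⟨c2, h1.trans h3, h4⟩
  | weaken _ hq ih =>
    obtain ⟨c1, h1, h2⟩ := ih h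
    exact ⟨c1, h1.weaken hq, h2⟩
  | right f p i hi =>
    exact ⟨_, .single (.down c i .right _ (by rw [h.finger i hi.le]; exact h.right _ hi)), h.move i _⟩
  | left f p i q hq hm =>
    refine ⟨_, .single (.up c i _ ⟨.right, ?_⟩), h.move i q⟩
    rw [h.finger i (by omega), hq]
    exact h.right q hm
  | copy f p i j hi =>
    refine ⟨_, (Steps.single (.save c i)).trans (.single (.load _ j (s (p i)) ?_)),
      { h.move j (p i) with }⟩
    simp [h.finger i hi]
  | exch f p i j hi hj =>
    by_cases e : p i = p j
    · refine ⟨c, (Steps.refl c).weaken (by omega), ?_⟩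
      rw [e, Equiv.swap_self]
      exact h
    · obtain ⟨c', h1, h2⟩ := h.exch hA hR i j hi hj e
      exact ⟨c', h1.weaken (by omega), h2⟩

theorem Realizes.sort [NeZero k] {L L' : List (LeafTree (Fin n))} (e : LeafTree (Fin n)) {D : ℕ}
    (hL : L.Perm L') (hD : L.length ≤ k ^ D) :
    Realizes k n V (LeafTree.comb L e) (LeafTree.comb L' e) (20 * L.length * D) := by
  intro c S hU hR
  obtain ⟨s, a, A, E, h0, hS, hl, hr, hA, hE, rfl⟩ := hR.exists_spine
  obtain ⟨f, hf⟩ := hL.exists_natPerm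
  have hlen := hL.length_eq
  have hlt : ∀ i, f i < L.length ↔ i < L.length := fun i => by
    have h1 := List.getElem?_eq_none_iff (l := L') (i := f i)
    rw [hf, List.getElem?_eq_none_iff] at h1
    omega
  have hlt' : ∀ i, f.symm i < L.length ↔ i < L.length := fun i => by rw [← hlt, Equiv.apply_symm_apply]
  obtain ⟨m, hm⟩ : ∃ m, m = L.length := ⟨_, rfl⟩
  -- Only finger 0 is known to be on the spine; position `m + 1` marks the others as unknown.
  obtain ⟨f', p', hM, hp', hid, -⟩ := ArrayMoves.exists_sort (k := k) (m := m) D 0 m f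
    (Function.update (fun _ => m + 1) 0 0) (by omega) (by omega) (by simp)
    (fun i _ hi => ⟨Nat.zero_le _, by have := hlt i; omega⟩)
  have hget : ∀ d (hd : d < L.length), L[f.symm d]'((hlt' d).2 hd) = L'[d]'(hlen ▸ hd) := by
    intro d hd
    have := hf (f.symm d)
    rw [Equiv.apply_symm_apply, List.getElem?_eq_getElem (hlen ▸ hd),
      List.getElem?_eq_getElem ((hlt' d).2 hd)] at this
    exact (Option.some_injective _ this).symm
  -- The subtrees are renumbered by destination from here on, so that the sorted array is the
  -- identity.
  have hS' : SpineSets m s (fun d => A (f.symm d)) E := by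
    subst hm
    exact ⟨fun i j hi hj => hS.notMem i _ hi ((hlt' j).2 hj), hS.inj,
      fun i j hi hj e => hS.disjoint _ _ ((hlt' i).2 hi) ((hlt' j).2 hj) (fun e' => e (f.symm.injective e')),
      hS.notMem_end, fun i hi => hS.disjoint_end _ ((hlt' i).2 hi)⟩
  have hA' : ∀ d < m, c.tree.Rep (a (f.symm d)) (L'.getD d e) (A (f.symm d)) := by
    intro d hd
    have hd' : d < L'.length := by omega
    rw [List.getD_eq_getElem _ _ hd', ← hget d (by omega)]
    exact hA _ _
  have hstart : OnSpine c m s (fun d => a (f.symm d)) f (Function.update (fun _ => m + 1) 0 0) c := by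
    subst hm
    refine ⟨fun i hi => ?_, hU, rfl, rfl, fun i hi => ?_, hr, fun _ _ => rfl, fun i hi => (hlt i).2 hi⟩
    · by_cases e : i = 0
      · subst e; simp [h0]
      · rw [Function.update_of_ne e] at hi; omega
    · simpa using hl i hi
  obtain ⟨c', hs, hc'⟩ := OnSpine.arrayMoves hS' hA' hM hstart
  have hout : ∀ u, (∀ i, i < m → u ≠ s i) → c'.tree.child u = c.tree.child u := hc'.outside
  have hun : spineUnion L.length s A E = spineUnion L'.length s (fun d => A (f.symm d)) E := by
    ext u
    simp only [spineUnion, Set.mem_ofPred_eq, ← hlen]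
    refine or_congr_left ⟨?_, ?_⟩
    · rintro ⟨i, hi, h | h⟩
      · exact ⟨i, hi, .inl h⟩
      · exact ⟨f i, (hlt i).2 hi, .inr (by simpa using h)⟩
    · rintro ⟨i, hi, h | h⟩
      · exact ⟨i, hi, .inl h⟩
      · exact ⟨f.symm i, (hlt' i).2 hi, .inr h⟩
  refine ⟨c', by rw [← hm]; exact hs, ⟨?_, hc'.unique, hc'.root, hc'.node, fun u hu => hout u
    fun i hi e => hu (.inl ⟨i, by omega, .inl e⟩)⟩, ?_⟩
  · rw [hc'.finger 0 (by omega), hp', h0]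
  · rw [hun, ← h0]
    have hm' : m = L'.length := by omega
    refine SpineSets.rep (a := fun d => a (f.symm d)) (hm' ▸ hS') (fun i hi => ?_)
      (fun i hi => hc'.right i (by omega)) (fun i hi => ?_) ?_
    · rw [hc'.left i (by omega), hid i (by omega) (by omega)]
    · have := (hA' i (by omega)).congr hc'.node fun u hu => hout u fun j hj e =>
        hS'.notMem j i hj (by omega) (e ▸ hu)
      rwa [List.getD_eq_getElem _ _ hi] at this
    · rw [← hlen]
      exact hE.congr hc'.node fun u hu => hout u fun j hj e => hS'.notMem_end j hj (e ▸ hu)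

theorem _root_.LeafTree.Reach.realizes [NeZero k] {t t' : LeafTree (Fin n)} {q : ℕ}
    (h : LeafTree.Reach k t t' q) : Realizes k n V t t' q := by
  induction h with
  | refl t => exact .refl t
  | trans _ _ h h' => exact h.trans h'
  | weaken _ hq h => exact h.weaken hq
  | left r _ h => exact h.left r
  | right l _ h => exact h.right l
  | flip l r => exact .flip l r
  | exch a b c => exact .exch a b c
  | sort L L' e D hL hD => exact .sort e hL hD

end FingerConfig

/-! ### Tournament trees and the transfer to actual accesses -/

namespace PointerTree

variable {V : Type*} {n : ℕ}

/-- A cycle through a node passes through its unique parent, hence climbs along the path to the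
root, which has no parent. -/
theorem IsTournament.not_transGen {T : PointerTree V n} (h : T.IsTournament) (v : V) :
    ¬ Relation.TransGen T.IsParent v v := by
  have hv := h.connected v
  induction hv with
  | refl =>
    intro hc
    obtain ⟨w, _, hw⟩ := Relation.TransGen.tail'_iff.1 hc
    exact h.root_no_parent w hw
  | tail _ hp ih =>
    intro hc
    obtain ⟨w, hvw, hw⟩ := Relation.TransGen.tail'_iff.1 hc
    obtain ⟨s, hs⟩ := hp
    obtain ⟨s', hs'⟩ := hw
    obtain rfl := (h.parent_unique _ _ _ _ _ hs hs').1
    exact ih (Relation.TransGen.head' ⟨s, hs⟩ hvw)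

theorem IsTournament.wellFounded [Finite V] {T : PointerTree V n} (h : T.IsTournament) :
    WellFounded fun v u => T.IsParent u v := by
  let r : V → V → Prop := fun v u => Relation.TransGen T.IsParent u v
  have : Std.Irrefl r := ⟨fun v => h.not_transGen v⟩
  have : IsTrans V r := ⟨fun _ _ _ h1 h2 => Relation.TransGen.trans h2 h1⟩
  exact Subrelation.wf (fun h => Relation.TransGen.single h) (Finite.wellFounded_of_trans_of_irrefl r)

/-- The ancestors of a node form a chain, so a common descendant would place one sibling below the
other and close a cycle through their parent. -/
theorem IsTournament.disjoint_children {T : PointerTree V n} (h : T.IsTournament) {v a b : V}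
    {s s' : Side} (ha : T.child v s = some a) (hb : T.child v s' = some b) (hs : s ≠ s') {u : V}
    (hu : T.InSubtree a u) (hu' : T.InSubtree b u) : False := by
  have key : ∀ {a b : V} {s s' : Side}, T.child v s = some a → T.child v s' = some b → s ≠ s' →
      ¬ T.InSubtree a b := by
    intro a b s s' ha hb hs hab
    rcases Relation.ReflTransGen.cases_tail hab with e | ⟨p, hp, s'', hpb⟩
    · exact hs (h.parent_unique _ _ _ _ _ ha (e ▸ hb)).2
    · obtain rfl := (h.parent_unique _ _ _ _ _ hpb hb).1
      exact h.not_transGen _ (Relation.TransGen.head' ⟨s, ha⟩ hp)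
  have hr : Relator.RightUnique (Function.swap T.IsParent) := by
    rintro x y z ⟨s, h1⟩ ⟨s', h2⟩
    exact (h.parent_unique _ _ _ _ _ h1 h2).1
  rcases Relation.ReflTransGen.total_of_right_unique hr (Relation.reflTransGen_swap.2 hu)
    (Relation.reflTransGen_swap.2 hu') with h1 | h1
  · exact key hb ha hs.symm (Relation.reflTransGen_swap.1 h1)
  · exact key ha hb hs (Relation.reflTransGen_swap.1 h1)

/-- Finiteness makes the child relation well-founded, so the shape can be read off from the leaves
upwards. -/
theorem IsTournament.exists_rep [Finite V] {T : PointerTree V n} (h : T.IsTournament) :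
    ∃ t, T.Rep T.root t Set.univ := by
  have key : ∀ v, ∃ t, T.Rep v t {u | T.InSubtree v u} := by
    intro v
    induction v using h.wellFounded.induction with
    | _ v ih =>
    by_cases hx : ∃ x, T.node x = v
    · obtain ⟨x, rfl⟩ := hx
      refine ⟨.leaf x, rfl, h.element_leaf x, ?_⟩
      ext u
      constructor
      · intro hu
        rcases Relation.ReflTransGen.cases_head hu with e | ⟨w, ⟨s, hs⟩, _⟩
        · exact e.symm
        · rw [h.element_leaf] at hs; cases hs
      · rintro rfl
        exact Relation.ReflTransGen.refl
    · push Not at hx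
      obtain ⟨a, ha⟩ := h.internal_children v hx .left
      obtain ⟨b, hb⟩ := h.internal_children v hx .right
      obtain ⟨l, hl⟩ := ih a ⟨_, ha⟩
      obtain ⟨r, hr⟩ := ih b ⟨_, hb⟩
      refine ⟨.node l r, a, b, _, _, ha, hb, hl, hr,
        fun hv => h.not_transGen v (Relation.TransGen.head' ⟨_, ha⟩ hv),
        fun hv => h.not_transGen v (Relation.TransGen.head' ⟨_, hb⟩ hv),
        Set.disjoint_left.2 fun u hu hu' => h.disjoint_children ha hb (by simp) hu hu', ?_⟩
      ext u
      simp only [Set.mem_ofPred_eq, Set.mem_insert_iff, Set.mem_union]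
      constructor
      · intro hu
        rcases Relation.ReflTransGen.cases_head hu with e | ⟨w, ⟨s, hs⟩, hw⟩
        · exact .inl e.symm
        · cases s with
          | left => rw [ha] at hs; cases hs; exact .inr (.inl hw)
          | right => rw [hb] at hs; cases hs; exact .inr (.inr hw)
      · rintro (rfl | hu | hu)
        · exact Relation.ReflTransGen.refl
        · exact Relation.ReflTransGen.head ⟨_, ha⟩ hu
        · exact Relation.ReflTransGen.head ⟨_, hb⟩ hu
  obtain ⟨t, ht⟩ := key T.root
  have : {u | T.InSubtree T.root u} = Set.univ := Set.eq_univ_of_forall h.connected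
  exact ⟨t, this ▸ ht⟩

theorem Rep.inSubtree {T : PointerTree V n} {v : V} {t : LeafTree (Fin n)} {S : Set V}
    (h : T.Rep v t S) {u : V} (hu : u ∈ S) : T.InSubtree v u := by
  induction t generalizing v S with
  | leaf x =>
    obtain ⟨_, _, rfl⟩ := h
    obtain rfl : u = v := hu
    exact Relation.ReflTransGen.refl
  | node l r hl hr =>
    obtain ⟨a, b, A, B, h1, h2, h3, h4, _, _, _, rfl⟩ := h
    rcases hu with rfl | hu | hu
    · exact Relation.ReflTransGen.refl
    · exact Relation.ReflTransGen.head ⟨_, h1⟩ (hl h3 hu)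
    · exact Relation.ReflTransGen.head ⟨_, h2⟩ (hr h4 hu)

theorem Rep.leaf {T : PointerTree V n} {v : V} {t : LeafTree (Fin n)} {S : Set V}
    (h : T.Rep v t S) {x : Fin n} (hx : x ∈ t.leaves) :
    T.node x ∈ S ∧ ∀ s, T.child (T.node x) s = none := by
  induction t generalizing v S with
  | leaf y =>
    obtain ⟨rfl, h2, rfl⟩ := h
    obtain rfl : x = y := by simpa [LeafTree.leaves] using hx
    exact ⟨rfl, h2⟩
  | node l r hl hr =>
    obtain ⟨a, b, A, B, h1, h2, h3, h4, _, _, _, rfl⟩ := h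
    rcases List.mem_append.1 (by simpa [LeafTree.leaves] using hx : x ∈ l.leaves ++ r.leaves)
      with hx | hx
    · exact ⟨.inr (.inl (hl h3 hx).1), (hl h3 hx).2⟩
    · exact ⟨.inr (.inr (hr h4 hx).1), (hr h4 hx).2⟩

theorem Rep.leaf_or_internal {T : PointerTree V n} {v : V} {t : LeafTree (Fin n)} {S : Set V}
    (h : T.Rep v t S) {u : V} (hu : u ∈ S) :
    (∃ x ∈ t.leaves, T.node x = u) ∨ ∀ s, ∃ w, T.child u s = some w := by
  induction t generalizing v S with
  | leaf y =>
    obtain ⟨rfl, h2, rfl⟩ := h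
    exact .inl ⟨y, by simp [LeafTree.leaves], (Set.mem_singleton_iff.1 hu).symm⟩
  | node l r hl hr =>
    obtain ⟨a, b, A, B, h1, h2, h3, h4, _, _, _, rfl⟩ := h
    rcases hu with rfl | hu | hu
    · exact .inr fun s => by
        cases s with
        | left => exact ⟨_, h1⟩
        | right => exact ⟨_, h2⟩
    · refine (hl h3 hu).imp_left fun ⟨x, hx, e⟩ => ⟨x, ?_, e⟩
      simp [LeafTree.leaves, hx]
    · refine (hr h4 hu).imp_left fun ⟨x, hx, e⟩ => ⟨x, ?_, e⟩
      simp [LeafTree.leaves, hx]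

theorem Rep.nodup {T : PointerTree V n} {v : V} {t : LeafTree (Fin n)} {S : Set V}
    (h : T.Rep v t S) : t.leaves.Nodup := by
  induction t generalizing v S with
  | leaf y => simp [LeafTree.leaves]
  | node l r hl hr =>
    obtain ⟨a, b, A, B, h1, h2, h3, h4, _, _, h7, rfl⟩ := h
    exact List.nodup_append'.2 ⟨hl h3, hr h4, fun x hx hx' =>
      Set.disjoint_left.1 h7 (h3.leaf hx).1 (h4.leaf hx').1⟩

theorem IsTournament.leaves_perm {T : PointerTree V n} (h : T.IsTournament)
    {t : LeafTree (Fin n)} (ht : T.Rep T.root t Set.univ) : t.leaves.Perm (List.finRange n) := by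
  refine (List.perm_ext_iff_of_nodup ht.nodup (List.nodup_finRange n)).2 fun x => ?_
  refine ⟨fun _ => List.mem_finRange x, fun _ => ?_⟩
  rcases ht.leaf_or_internal (Set.mem_univ (T.node x)) with ⟨y, hy, e⟩ | hs
  · exact h.node_injective e ▸ hy
  · obtain ⟨w, hw⟩ := hs .left
    rw [h.element_leaf] at hw
    cases hw

theorem Rep.isTournament {T : PointerTree V n} {t : LeafTree (Fin n)}
    (ht : T.Rep T.root t Set.univ) (hU : T.UniqueParent) (hinj : Function.Injective T.node)
    (hx : ∀ x, x ∈ t.leaves) : T.IsTournament where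
  root_no_parent := fun _ ⟨_, hs⟩ => (ht.closed (Set.mem_univ _) hs).2 rfl
  parent_unique := hU
  connected v := ht.inSubtree (Set.mem_univ v)
  node_injective := hinj
  element_leaf x := (ht.leaf (hx x)).2
  internal_children v hv s := by
    rcases ht.leaf_or_internal (Set.mem_univ v) with ⟨x, _, e⟩ | h
    · exact absurd e (hv x)
    · exact h s

/-- After the rearrangement the element is at most one step below the main finger, so each access
needs at most 2 further operations. -/
theorem _root_.LeafTree.Serves.canServe {k : ℕ} [NeZero k] {t t' : LeafTree (Fin n)}
    {A : List (Fin n)} {c : ℕ} (h : LeafTree.Serves k t A t' c) {T : PointerTree V n}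
    (hT : T.IsTournament) (ht : T.Rep T.root t Set.univ) :
    ∃ q ≤ c + 2 * A.length, T.CanServe k A q := by
  induction h generalizing T with
  | nil t => exact ⟨0, by simp, .nil T⟩
  | @cons t t₁ t₂ x A c c' hR hx _ ih =>
    obtain ⟨c₁, hs, hl, hr⟩ := hR.realizes (FingerConfig.start k T) _ hT.parent_unique ht
    have hroot : c₁.tree.root = T.root := hl.root
    have hfin : c₁.finger 0 = T.root := hl.finger
    have hr' : c₁.tree.Rep T.root t₁ Set.univ := hr
    have hT' : c₁.tree.IsTournament := by
      refine Rep.isTournament (hroot ▸ hr') hl.unique ?_ fun y => ?_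
      · rw [hl.node]; exact hT.node_injective
      · rw [← hR.leaves_perm.mem_iff, (hT.leaves_perm ht).mem_iff]; exact List.mem_finRange y
    obtain ⟨q, hq, hA⟩ := ih hT' (hroot ▸ hr')
    have hrun : ∃ q ≤ 2, FingerConfig.Run c₁ x q c₁.tree := by
      rcases hx with rfl | ⟨r, rfl⟩
      · exact ⟨1, by omega, .serve c₁ 0 x (hfin.trans hr'.1)⟩
      · obtain ⟨a, b, _, _, h1, _, h2, _⟩ := hr'
        exact ⟨2, le_rfl, .step _ _ _ _ _ (.down c₁ 0 .left a (by rw [hfin]; exact h1))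
          (.serve { c₁ with finger := _ } 0 x (by simpa using h2.1))⟩
    obtain ⟨q₁, hq₁, hrun⟩ := hrun
    obtain ⟨q₂, hq₂, hrun⟩ := hs.run hrun
    exact ⟨q₂ + q, by simp only [List.length_cons]; omega, .cons T _ x A q₂ q hrun hT' hA⟩

end PointerTree

/-! ### Filing elements by the time of their next request -/

namespace LeafTree

variable {α β : Type*} {k : ℕ}

theorem bind_congr {f g : α → LeafTree β} {t : LeafTree α} (h : ∀ i ∈ t.leaves, f i = g i) :
    t.bind f = t.bind g := by
  induction t with
  | leaf a => exact h a (by simp [leaves])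
  | node l r hl hr =>
    simp only [bind]
    rw [hl fun i hi => h i (by simp [leaves, hi]), hr fun i hi => h i (by simp [leaves, hi])]

/-- For `a < b < 2 ^ r` there is a unique scale at which `a` and `b` lie in the two halves of one
dyadic block. -/
theorem exists_scale {a b : ℕ} (r : ℕ) (hab : a < b) (hb : b < 2 ^ r) :
    ∃ j < r, a / 2 ^ (j + 1) = b / 2 ^ (j + 1) ∧ a / 2 ^ j % 2 = 0 ∧ b / 2 ^ j % 2 = 1 := by
  induction r generalizing a b with
  | zero => simp at hb; omega
  | succ r ih =>
    by_cases h : a / 2 = b / 2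
    · refine ⟨0, by omega, by simpa using h, ?_, ?_⟩ <;> simp <;> omega
    · obtain ⟨j, hj, h1, h2, h3⟩ := ih (a := a / 2) (b := b / 2) (by omega) (by rw [pow_succ] at hb; omega)
      refine ⟨j + 1, by omega, ?_, ?_, ?_⟩
      · rw [pow_succ' 2 (j + 1), ← Nat.div_div_eq_div_mul, ← Nat.div_div_eq_div_mul]; exact h1
      · rw [pow_succ', ← Nat.div_div_eq_div_mul]; exact h2
      · rw [pow_succ', ← Nat.div_div_eq_div_mul]; exact h3

variable [DecidableEq α]

/-- The lists `ℓ` at time `t`, when the requests `A` are still to come at the times `t + 1, t + 2, …`: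
an element of list `i` is requested next in the second half of the dyadic block of length `2 ^ (i + 1)`
that contains `t`.  The credit `cr i` pays for sorting list `i`, unless the list is already sorted and
cannot grow before it is empty. -/
structure Scheduled (r : ℕ) (R : List α) (t : ℕ) (A : List α) (ℓ : Fin r → List α)
    (cr : Fin r → ℕ) : Prop where
  nodup : ∀ i, (ℓ i).Nodup
  disjoint : ∀ i j y, y ∈ ℓ i → y ∈ ℓ j → i = j
  subset : ∀ i, ℓ i ⊆ R
  place : ∀ i, ∀ y ∈ ℓ i, t / 2 ^ (i.val + 1) = (t + 1 + A.idxOf y) / 2 ^ (i.val + 1) ∧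
    (t + 1 + A.idxOf y) / 2 ^ i.val % 2 = 1
  credit : ∀ i, (ℓ i).length ≤ cr i ∨
    (ℓ i).Pairwise (fun y z => A.idxOf y ≤ A.idxOf z) ∧ (ℓ i = [] ∨ t / 2 ^ i.val % 2 = 1)

/-- A remaining element is requested after `t + 1`, and `t` and that request share a block of length
`2 ^ (i + 1)`, so `t + 1` lies in it too. Hence digit `i`, once 1, stays 1 while the list is
nonempty. -/
theorem Scheduled.advance {r : ℕ} {R : List α} {t : ℕ} {x : α} {A : List α} {ℓ ℓ' : Fin r → List α}
    {cr cr' : Fin r → ℕ} (h : Scheduled r R t (x :: A) ℓ cr) (hnd : ∀ i, (ℓ' i).Nodup)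
    (hsub : ∀ i, ∀ y ∈ ℓ' i, y ∈ ℓ i ∧ x ≠ y)
    (hcr : ∀ i, ℓ' i = ℓ i ∧ cr' i = cr i ∨
      (ℓ' i).Pairwise (fun y z => A.idxOf y ≤ A.idxOf z) ∧ (t + 1) / 2 ^ i.val % 2 = 1) :
    Scheduled r R (t + 1) A ℓ' cr' := by
  have hplace : ∀ i, ∀ y ∈ ℓ' i, t / 2 ^ (i.val + 1) = (t + 1) / 2 ^ (i.val + 1) ∧
      (t + 1) / 2 ^ (i.val + 1) = (t + 1 + 1 + A.idxOf y) / 2 ^ (i.val + 1) ∧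
      (t + 1 + 1 + A.idxOf y) / 2 ^ i.val % 2 = 1 := by
    intro i y hy
    obtain ⟨h1, h2⟩ := hsub i y hy
    have h3 := h.place i y h1
    rw [List.idxOf_cons_ne _ h2] at h3
    have e : t + 1 + (A.idxOf y).succ = t + 1 + 1 + A.idxOf y := by omega
    rw [e] at h3
    have m1 : t / 2 ^ (i.val + 1) ≤ (t + 1) / 2 ^ (i.val + 1) := Nat.div_le_div_right (by omega)
    have m2 : (t + 1) / 2 ^ (i.val + 1) ≤ (t + 1 + 1 + A.idxOf y) / 2 ^ (i.val + 1) :=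
      Nat.div_le_div_right (by omega)
    exact ⟨by omega, by omega, h3.2⟩
  refine ⟨hnd, fun i j y hi hj => h.disjoint i j y (hsub i y hi).1 (hsub j y hj).1,
    fun i y hy => h.subset i (hsub i y hy).1, fun i y hy => (hplace i y hy).2, fun i => ?_⟩
  rcases hcr i with ⟨h1, h2⟩ | ⟨h1, h2⟩
  · rcases h.credit i with h3 | ⟨h3, h4⟩
    · exact .inl (by rw [h1, h2]; exact h3)
    · refine .inr ⟨?_, ?_⟩
      · rw [← h1] at h3
        refine h3.imp_of_mem fun {y z} hy hz hyz => ?_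
        rw [List.idxOf_cons_ne _ (hsub i y hy).2, List.idxOf_cons_ne _ (hsub i z hz).2] at hyz
        omega
      · by_cases e : ℓ' i = []
        · exact .inl e
        obtain ⟨y, hy⟩ := List.exists_mem_of_ne_nil _ e
        have h5 := (hplace i y hy).1
        have h6 := h4.resolve_left (h1 ▸ e)
        rw [pow_succ, ← Nat.div_div_eq_div_mul, ← Nat.div_div_eq_div_mul] at h5
        have m1 : t / 2 ^ i.val ≤ (t + 1) / 2 ^ i.val := Nat.div_le_div_right (by omega)
        right; omega
  · exact .inr ⟨h1, .inr h2⟩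

/-- A request to `x` in list `i` forces digit `i` of `t + 1` to be 1. Either the list is already
sorted and `x` is its head, or its credit pays for sorting it now; the credit may then be reset to
0. -/
theorem Scheduled.pop {r : ℕ} {R : List α} {t : ℕ} {x : α} {A : List α} {ℓ : Fin r → List α}
    {cr : Fin r → ℕ} (h : Scheduled r R t (x :: A) ℓ cr) {i : Fin r} (hx : x ∈ ℓ i) :
    ∃ L, (ℓ i).Perm (x :: L) ∧ (ℓ i = x :: L ∨ (ℓ i).length ≤ cr i) ∧
      Scheduled r R (t + 1) A (Function.update ℓ i L) (Function.update cr i 0) ∧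
      ∀ j, x ∉ Function.update ℓ i L j := by
  have hodd : (t + 1) / 2 ^ i.val % 2 = 1 := by
    have := (h.place i x hx).2
    rwa [List.idxOf_cons_self, add_zero] at this
  have hL : ∃ L, (ℓ i).Perm (x :: L) ∧ (ℓ i = x :: L ∨ (ℓ i).length ≤ cr i) ∧
      L.Pairwise (fun y z => A.idxOf y ≤ A.idxOf z) := by
    rcases h.credit i with h1 | ⟨h1, _⟩
    · let ρ : α → α → Prop := fun y z => A.idxOf y ≤ A.idxOf z
      have : Std.Total ρ := ⟨fun y z => le_total _ _⟩
      have : IsTrans α ρ := ⟨fun y z u h1 h2 => le_trans h1 h2⟩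
      exact ⟨((ℓ i).erase x).insertionSort ρ,
        (List.perm_cons_erase hx).trans ((List.perm_insertionSort ρ _).symm.cons x), .inr h1,
        List.pairwise_insertionSort ρ _⟩
    · rcases e : ℓ i with _ | ⟨y, L⟩
      · rw [e] at hx; cases hx
      · rw [e, List.pairwise_cons] at h1
        have hnd := h.nodup i
        rw [e, List.nodup_cons] at hnd
        have hy : x = y := by
          rw [e] at hx
          rcases List.mem_cons.1 hx with hx | hx
          · exact hx
          · have := h1.1 x hx
            by_contra hne
            rw [List.idxOf_cons_self, List.idxOf_cons_ne _ hne] at this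
            omega
        subst hy
        refine ⟨L, .refl _, .inl rfl, h1.2.imp_of_mem fun {y z} hy hz hyz => ?_⟩
        rw [List.idxOf_cons_ne _ (by rintro rfl; exact hnd.1 hy),
          List.idxOf_cons_ne _ (by rintro rfl; exact hnd.1 hz)] at hyz
        omega
  obtain ⟨L, hp, hL, hs⟩ := hL
  have hnd : (x :: L).Nodup := hp.nodup_iff.1 (h.nodup i)
  rw [List.nodup_cons] at hnd
  have hmem : ∀ j, ∀ y ∈ Function.update ℓ i L j, y ∈ ℓ j ∧ x ≠ y := by
    intro j y hy
    by_cases e : j = i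
    · subst e
      rw [Function.update_self] at hy
      exact ⟨hp.symm.subset (by simp [hy]), by rintro rfl; exact hnd.1 hy⟩
    · rw [Function.update_of_ne e] at hy
      refine ⟨hy, ?_⟩
      rintro rfl
      exact e (h.disjoint _ _ _ hy hx)
  refine ⟨L, hp, hL, h.advance (fun j => ?_) hmem (fun j => ?_), fun j hj => (hmem j x hj).2 rfl⟩
  · by_cases e : j = i
    · subst e; rw [Function.update_self]; exact hnd.2
    · rw [Function.update_of_ne e]; exact h.nodup j
  · by_cases e : j = i
    · subst e; rw [Function.update_self]; exact .inr ⟨hs, hodd⟩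
    · rw [Function.update_of_ne e, Function.update_of_ne e]; exact .inl ⟨rfl, rfl⟩

/-- The new list has digit `j` of `t` equal to 0, so it is either empty or fully covered by credit,
and one more credit suffices. An element never requested again counts as requested just after the
end, which is why `ht` has to include that moment. -/
theorem Scheduled.push {r : ℕ} {R : List α} {t : ℕ} {x : α} {A : List α} {ℓ : Fin r → List α}
    {cr : Fin r → ℕ} (h : Scheduled r R t A ℓ cr) (hx : ∀ j, x ∉ ℓ j) (hR : x ∈ R)
    (ht : t + 1 + A.length < 2 ^ r) :
    ∃ j, Scheduled r R t A (Function.update ℓ j (x :: ℓ j)) (Function.update cr j (cr j + 1)) := by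
  have hlen := List.idxOf_le_length (a := x) (l := A)
  obtain ⟨j, hj, h1, h2, h3⟩ := exists_scale r (a := t) (b := t + 1 + A.idxOf x) (by omega) (by omega)
  obtain ⟨j, rfl⟩ : ∃ j' : Fin r, j'.val = j := ⟨⟨j, hj⟩, rfl⟩
  have hmem : ∀ i, ∀ y ∈ Function.update ℓ j (x :: ℓ j) i, y ∈ ℓ i ∨ y = x ∧ i = j := by
    intro i y hy
    by_cases e : i = j
    · subst e
      rw [Function.update_self, List.mem_cons] at hy
      tauto
    · rw [Function.update_of_ne e] at hy; exact .inl hy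
  refine ⟨j, fun i => ?_, fun i i' y hi hi' => ?_, fun i y hy => ?_, fun i y hy => ?_, fun i => ?_⟩
  · by_cases e : i = j
    · subst e; rw [Function.update_self]; exact List.nodup_cons.2 ⟨hx i, h.nodup i⟩
    · rw [Function.update_of_ne e]; exact h.nodup i
  · rcases hmem i y hi with g1 | ⟨rfl, rfl⟩
    · rcases hmem i' y hi' with g2 | ⟨rfl, rfl⟩
      · exact h.disjoint _ _ _ g1 g2
      · exact absurd g1 (hx _)
    · rcases hmem i' y hi' with g2 | ⟨_, rfl⟩
      · exact absurd g2 (hx _)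
      · rfl
  · rcases hmem i y hy with g | ⟨rfl, _⟩
    · exact h.subset i g
    · exact hR
  · rcases hmem i y hy with g | ⟨rfl, rfl⟩
    · exact h.place i y g
    · exact ⟨h1, h3⟩
  · by_cases e : i = j
    · subst e
      rw [Function.update_self, Function.update_self, List.length_cons]
      left
      rcases h.credit i with g | ⟨_, g | g⟩
      · omega
      · rw [g]; simp
      · omega
    · rw [Function.update_of_ne e, Function.update_of_ne e]; exact h.credit i

theorem sum_update_add {r : ℕ} (f : Fin r → ℕ) (i : Fin r) (v : ℕ) :
    ∑ j, Function.update f i v j + f i = ∑ j, f j + v := by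
  rw [Finset.sum_update_of_mem (Finset.mem_univ i),
    Finset.sum_eq_add_sum_sdiff_singleton i f (fun h => absurd (Finset.mem_univ i) h)]
  ring

end LeafTree

/-! ### Simulation by accesses to a tree of lists -/

namespace LeafTree

variable {α : Type*} {k : ℕ}

theorem Top.exists_node {x : α} {t : LeafTree α} (h : Top x t) (ht : 2 ≤ t.leaves.length) :
    ∃ r, t = node (leaf x) r := by
  rcases h with rfl | h
  · simp [leaves] at ht
  · exact h

/-- The tree whose leaf `i` carries the anchor `a i` and the list `ℓ i`. -/
abbrev attachLists {r : ℕ} (a : Fin r → α) (ℓ : Fin r → List α) (w : LeafTree (Fin r)) : LeafTree α :=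
  w.bind fun i => chain (a i) (ℓ i)

theorem attachLists_update {r : ℕ} (a : Fin r → α) (ℓ : Fin r → List α) (i : Fin r) (L : List α)
    {m : LeafTree (Fin r)} (h : (node (leaf i) m).leaves.Nodup) :
    attachLists a (Function.update ℓ i L) (node (leaf i) m) = node (chain (a i) L) (attachLists a ℓ m) := by
  have : i ∉ m.leaves := by
    have h' : (i :: m.leaves).Nodup := h
    exact (List.nodup_cons.1 h').1
  simp only [attachLists, bind, Function.update_self]
  congr 1
  refine bind_congr fun j hj => ?_
  rw [Function.update_of_ne (by rintro rfl; exact this hj)]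

/-- The accesses of `A` are served through a sequence of at most `2 * A.length` accesses to the lists. -/
theorem Scheduled.exists_virtual [DecidableEq α] {r D : ℕ} {R : List α} (hR : R.length ≤ k ^ D) (a : Fin r → α)
    (A : List α) (t : ℕ) (ℓ : Fin r → List α) (cr : Fin r → ℕ) (h : Scheduled r R t A ℓ cr)
    (ht : t + 1 + A.length < 2 ^ r) (hA : ∀ x ∈ A, (∃ i, x = a i) ∨ ∃ i, x ∈ ℓ i) :
    ∃ B : List (Fin r), B.length ≤ 2 * A.length ∧ ∀ (w w' : LeafTree (Fin r)) (c c₀ : ℕ)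
      (s : LeafTree α), w.leaves.Nodup → 2 ≤ w.leaves.length → Serves k w B w' c →
      Reach k s (attachLists a ℓ w) c₀ →
      ∃ s' c', Serves k s A s' c' ∧
        c' ≤ c₀ + c + 160 * A.length + (20 * D + 80) * (A.length + ∑ i, cr i) := by
  induction A generalizing t ℓ cr with
  | nil => exact ⟨[], by simp, fun w w' c c₀ s _ _ _ _ => ⟨s, 0, .nil s, by omega⟩⟩
  | cons x A ih =>
    rw [List.length_cons] at ht
    by_cases hx : ∃ i, x ∈ ℓ i
    · obtain ⟨i, hxi⟩ := hx
      obtain ⟨L, hp, hL, h1, hx1⟩ := h.pop hxi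
      obtain ⟨j, h2⟩ := h1.push hx1 (h.subset i hxi) (by omega)
      have hsum1 := sum_update_add cr i 0
      have hsum2 := sum_update_add (Function.update cr i 0) j (Function.update cr i 0 j + 1)
      obtain ⟨ℓ₁, hℓ₁⟩ : ∃ ℓ₁, ℓ₁ = Function.update ℓ i L := ⟨_, rfl⟩
      obtain ⟨cr₁, hcr₁⟩ : ∃ cr₁, cr₁ = Function.update cr i 0 := ⟨_, rfl⟩
      rw [← hcr₁] at h1 h2 hsum1 hsum2
      obtain ⟨cr₂, hcr₂⟩ : ∃ cr₂, cr₂ = Function.update cr₁ j (cr₁ j + 1) := ⟨_, rfl⟩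
      rw [← hcr₂] at h2 hsum2
      rw [← hℓ₁] at h1 h2 hx1
      have hmem1 : ∀ i' y, y ∈ ℓ i' → y = x ∨ y ∈ ℓ₁ i' := by
        intro i' y hy
        by_cases e : i' = i
        · subst e
          rw [hℓ₁, Function.update_self]
          exact List.mem_cons.1 (hp.subset hy)
        · right; rw [hℓ₁, Function.update_of_ne e]; exact hy
      obtain ⟨B, hB, hsim⟩ := ih (t + 1) _ cr₂ h2 (by omega) fun y hy => by
        rcases hA y (by simp [hy]) with g | ⟨i', g⟩
        · exact .inl g
        · right
          rcases hmem1 i' y g with rfl | g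
          · exact ⟨j, by rw [Function.update_self]; simp⟩
          · refine ⟨i', ?_⟩
            by_cases e : i' = j
            · subst e; rw [Function.update_self]; simp [g]
            · rw [Function.update_of_ne e]; exact g
      refine ⟨i :: j :: B, by simp only [List.length_cons]; omega, ?_⟩
      intro w w' c c₀ s hw hw2 hS hs
      cases hS with
      | @cons _ w₁ _ _ _ c₁ _ hR₁ hT₁ hS =>
      cases hS with
      | @cons _ w₂ _ _ _ c₂ c₃ hR₂ hT₂ hS =>
      have hw₁ := hR₁.leaves_perm
      have hw₂ := hw₁.trans hR₂.leaves_perm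
      obtain ⟨M₁, rfl⟩ := hT₁.exists_node (hw₁.length_eq ▸ hw2)
      obtain ⟨M₂, rfl⟩ := hT₂.exists_node (hw₂.length_eq ▸ hw2)
      have e1 := attachLists_update a ℓ i L (hw₁.nodup_iff.1 hw)
      have e2 := attachLists_update a ℓ₁ j (x :: ℓ₁ j) (hw₂.nodup_iff.1 hw)
      rw [← hℓ₁] at e1
      have hsort : Reach k (chain (a i) (ℓ i)) (chain (a i) (x :: L)) ((20 * D + 80) * cr i) := by
        rcases hL with g | g
        · rw [g]; exact (Reach.refl _).weaken (by omega)
        · refine (Reach.chain_perm (D := D) (a i) hp ?_).weaken (by gcongr)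
          exact ((h.nodup i).subperm (h.subset i)).length_le.trans hR
      -- `hs` is work left over from the previous request; the push of `x` (`p2`) is likewise
      -- deferred to the next one. Meanwhile `x` stays beside the root and the tree of lists is
      -- rearranged below it.
      have p1 := (hs.trans (hR₁.bind _)).trans
        ((hsort.left (attachLists a ℓ M₁)).trans (Reach.pop (a i) x L _))
      rw [← e1] at p1
      have p2 := ((hR₂.bind fun i => chain (a i) (ℓ₁ i)).right (leaf x)).trans
        (Reach.push (a j) x (ℓ₁ j) (attachLists a ℓ₁ M₂))
      rw [← e2] at p2
      obtain ⟨s', c', hs', hc'⟩ := hsim _ w' c₃ _ _ (hw₂.nodup_iff.1 hw)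
        (hw₂.length_eq ▸ hw2) hS p2
      refine ⟨s', _, .cons p1 (.inr ⟨_, rfl⟩) hs', ?_⟩
      -- The sort spends all credit of list `i`, and the push buys one unit, charged to the present
      -- access.
      have hsum : ∑ i, cr₂ i + cr i = ∑ i, cr i + 1 := by omega
      have hE : (20 * D + 80) * (A.length + ∑ i, cr₂ i) + (20 * D + 80) * cr i =
          (20 * D + 80) * ((x :: A).length + ∑ i, cr i) := by
        rw [← mul_add, List.length_cons]; congr 1; omega
      rw [List.length_cons] at hE ⊢
      omega
    · have hx' : ∀ i, x ∉ ℓ i := fun i hi => hx ⟨i, hi⟩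
      obtain ⟨i, rfl⟩ := (hA x (by simp)).resolve_right hx
      have h1 : Scheduled r R (t + 1) A ℓ cr := h.advance h.nodup
        (fun i y hy => ⟨hy, by rintro rfl; exact hx' i hy⟩) fun i => .inl ⟨rfl, rfl⟩
      obtain ⟨B, hB, hsim⟩ := ih (t + 1) ℓ cr h1 (by omega) fun y hy => hA y (by simp [hy])
      refine ⟨i :: B, by simp only [List.length_cons]; omega, ?_⟩
      intro w w' c c₀ s hw hw2 hS hs
      cases hS with
      | @cons _ w₁ _ _ _ c₁ c₂ hR₁ hT₁ hS =>
      have hw₁ := hR₁.leaves_perm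
      obtain ⟨M, rfl⟩ := hT₁.exists_node (hw₁.length_eq ▸ hw2)
      have p1 := hs.trans (hR₁.bind fun i => chain (a i) (ℓ i))
      have hE : (20 * D + 80) * (A.length + ∑ i, cr i) ≤
          (20 * D + 80) * ((a i :: A).length + ∑ i, cr i) := by
        gcongr; simp
      -- A requested anchor needs no refiling: one rotation exposes it, and the inverse rotation is
      -- charged to the next request.
      have key : ∃ u, Reach k (attachLists a ℓ (node (leaf i) M)) u 16 ∧ Top (a i) u ∧
          Reach k u (attachLists a ℓ (node (leaf i) M)) 16 := by
        rcases e : ℓ i with _ | ⟨y, L⟩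
        · refine ⟨_, (Reach.refl _).weaken (by omega), .inr ⟨attachLists a ℓ M, ?_⟩,
            (Reach.refl _).weaken (by omega)⟩
          simp [attachLists, bind, e, chain]
        · refine ⟨node (leaf (a i)) (node (chain y L) (attachLists a ℓ M)), ?_, .inr ⟨_, rfl⟩, ?_⟩
          · simpa [attachLists, bind, e, chain] using Reach.assoc (k := k) _ _ _
          · simpa [attachLists, bind, e, chain] using Reach.assoc_symm (k := k) _ _ _
      obtain ⟨u, hu1, hu2, hu3⟩ := key
      obtain ⟨s', c', hs', hc'⟩ := hsim _ w' c₂ _ u (hw₁.nodup_iff.1 hw)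
        (hw₁.length_eq ▸ hw2) hS hu3
      refine ⟨s', _, .cons (p1.trans hu1) hu2 hs', ?_⟩
      rw [List.length_cons] at hE ⊢
      omega

/-- Every sequence of accesses to a tree with `n` leaves can be served with cost `f` per access and
additional cost `g`. -/
def ServedWithin (k n : ℕ) (f g : ℝ) : Prop :=
  ∀ (α : Type) (t : LeafTree α) (A : List α), t.leaves.Nodup → t.leaves.length = n →
    (∀ x ∈ A, x ∈ t.leaves) → ∃ t' c, Serves k t A t' c ∧ (c : ℝ) ≤ A.length * f + g

theorem ServedWithin.naive (k n : ℕ) : ServedWithin k n (22 * n) 0 := by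
  intro α t A _ hn hA
  obtain ⟨t', h⟩ := Serves.exists_naive (k := k) A t hA
  refine ⟨t', _, h, ?_⟩
  rw [hn]
  push_cast
  nlinarith

theorem comb_map_leaf_chain {K : List α} (hK : K ≠ []) (z : α) (L : List α) :
    ∃ x K', K ++ z :: L = x :: K' ∧ comb (K.map leaf) (chain z L) = chain x K' := by
  rcases K with _ | ⟨x, K⟩
  · exact absurd rfl hK
  · exact ⟨x, K ++ z :: L, rfl, (comb_chain x L K z).symm⟩

/-- The initial arrangement with anchors and lists. -/
theorem Reach.exists_attachLists {p D : ℕ} (hp : 1 ≤ p) {t : LeafTree α} (hpn : p < t.leaves.length)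
    (hD : t.leaves.length ≤ k ^ D) :
    ∃ (a : Fin (p + 1) → α) (R : List α) (w : LeafTree (Fin (p + 1))),
      w.leaves = List.finRange (p + 1) ∧ R.Sublist t.leaves ∧
      (∀ x ∈ t.leaves, (∃ i, x = a i) ∨ x ∈ R) ∧
      Reach k t (attachLists a (Function.update (fun _ => []) (Fin.last p) R) w)
        ((20 * D + 124) * t.leaves.length) := by
  obtain ⟨l, hl⟩ : ∃ l, l = t.leaves := ⟨_, rfl⟩
  rw [← hl] at hpn hD ⊢
  have hsplit : l.take p ++ l[p] :: l.drop (p + 1) = l := by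
    rw [List.cons_getElem_drop_succ, List.take_append_drop]
  have htake : (List.finRange p).map (fun i => l[i.val]) = l.take p := by
    apply List.ext_getElem
    · simp; omega
    · intro i h1 h2; simp
  obtain ⟨x, K, hK, hcomb⟩ := comb_map_leaf_chain (K := l.take p)
    (by rw [← List.length_pos_iff, List.length_take]; omega) l[p] (l.drop (p + 1))
  rw [hsplit] at hK
  -- The first `p + 1` leaves become anchors and all others go into the last list. With the other
  -- lists empty, the whole tree is a single caterpillar.
  refine ⟨fun i => l[i.val], l.drop (p + 1),
    comb ((List.finRange p).map fun i => leaf i.castSucc) (leaf (Fin.last p)), ?_,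
    List.drop_sublist _ _, fun y hy => ?_, ?_⟩
  · rw [leaves_comb, List.finRange_succ_last, List.flatMap_map]
    simp [leaves, List.map_eq_flatMap]
  · rw [← List.take_append_drop (p + 1) l, List.mem_append] at hy
    refine hy.imp_left fun hy => ?_
    obtain ⟨i, hi, rfl⟩ := List.mem_take_iff_getElem.1 hy
    exact ⟨⟨i, by omega⟩, rfl⟩
  · have h := Reach.arrange (k := k) (t := t) (a := x) (L := K) (D := D) (by rw [← hl, hK])
      (by have := congrArg List.length hK; simp at this; omega)
    rw [← hcomb, ← hl] at h
    convert h using 1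
    rw [attachLists, bind_comb, List.map_map, ← htake, List.map_map]
    congr 1
    · refine List.map_congr_left fun i _ => ?_
      simp only [Function.comp, LeafTree.bind]
      rw [Function.update_of_ne (Fin.castSucc_lt_last i).ne]
      rfl
    · simp [LeafTree.bind]

end LeafTree

/-! ### The recursion and its solution -/

namespace LeafTree

variable {k : ℕ}

theorem ServedWithin.mono {n : ℕ} {f f' g g' : ℝ} (h : ServedWithin k n f g) (hf : f ≤ f')
    (hg : g ≤ g') : ServedWithin k n f' g' := by
  intro α t A h1 h2 h3
  obtain ⟨t', c, hS, hc⟩ := h α t A h1 h2 h3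
  refine ⟨t', c, hS, hc.trans ?_⟩
  gcongr

/-- With the clock started at `2 ^ p - 1`, every coming request falls in the second half of the
block of length `2 ^ (p + 1)`, so everything belongs to the last list. Its initial credit pays for
its first sort. -/
theorem scheduled_initial {α : Type*} [DecidableEq α] {p : ℕ} {R A : List α} (hR : R.Nodup)
    (hA : A.length < 2 ^ p) :
    Scheduled (p + 1) R (2 ^ p - 1) A (Function.update (fun _ => []) (Fin.last p) R)
      (Function.update (fun _ => 0) (Fin.last p) R.length) := by
  have hmem : ∀ i y, y ∈ Function.update (fun _ : Fin (p + 1) => ([] : List α)) (Fin.last p) R i →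
      y ∈ R ∧ i = Fin.last p := by
    intro i y hy
    by_cases e : i = Fin.last p
    · subst e; rw [Function.update_self] at hy; exact ⟨hy, rfl⟩
    · rw [Function.update_of_ne e] at hy; cases hy
  refine ⟨fun i => ?_, fun i j y hi hj => (hmem i y hi).2.trans (hmem j y hj).2.symm,
    fun i y hy => (hmem i y hy).1, fun i y hy => ?_, fun i => .inl ?_⟩
  · by_cases e : i = Fin.last p
    · subst e; rw [Function.update_self]; exact hR
    · rw [Function.update_of_ne e]; exact List.nodup_nil
  · obtain ⟨_, rfl⟩ := hmem i y hy
    have hpos : 0 < 2 ^ p := by positivity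
    have hidx := List.idxOf_le_length (a := y) (l := A)
    have e : 2 ^ p - 1 + 1 + A.idxOf y = A.idxOf y + 2 ^ p := by omega
    rw [e, Fin.val_last, Nat.add_div_right _ hpos, Nat.div_eq_of_lt (by omega), pow_succ,
      Nat.div_eq_of_lt (by omega), Nat.div_eq_of_lt (by omega)]
    exact ⟨rfl, rfl⟩
  · by_cases e : i = Fin.last p
    · subst e; rw [Function.update_self, Function.update_self]
    · rw [Function.update_of_ne e, Function.update_of_ne e]; rfl

theorem ServedWithin.short {p D n : ℕ} {f g : ℝ} (hp : 1 ≤ p) (hpn : p < n) (hn : n < 2 ^ p)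
    (hD : n ≤ k ^ D) (hf : 0 ≤ f) (h : ServedWithin k (p + 1) f g) {α : Type} {t : LeafTree α}
    {A : List α} (hnd : t.leaves.Nodup) (hlen : t.leaves.length = n) (hA : ∀ x ∈ A, x ∈ t.leaves)
    (hAn : A.length ≤ n) : ∃ t' c, Serves k t A t' c ∧
      (c : ℝ) ≤ A.length * (2 * f + (20 * D + 240)) + (g + (40 * D + 204) * n) := by
  classical
  subst hlen
  obtain ⟨a, R, w, hw, hR, hmem, hreach⟩ := Reach.exists_attachLists hp hpn hD
  obtain ⟨B, hB, hsim⟩ := Scheduled.exists_virtual (k := k) (hR.length_le.trans hD) a A _ _ _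
    (scheduled_initial (p := p) (A := A) (hR.nodup hnd) (by omega)) (by rw [pow_succ]; omega)
    (fun x hx => by
      rcases hmem x (hA x hx) with g | g
      · exact .inl g
      · exact .inr ⟨Fin.last p, by rwa [Function.update_self]⟩)
  obtain ⟨w', c, hS, hc⟩ := h (Fin (p + 1)) w B (hw ▸ List.nodup_finRange _) (by simp [hw])
    (fun i _ => hw ▸ List.mem_finRange i)
  obtain ⟨t', c', hS', hc'⟩ := hsim w w' c _ t (hw ▸ List.nodup_finRange _) (by simp [hw]; omega)
    hS hreach
  refine ⟨t', c', hS', ?_⟩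
  have hsum : ∑ i, Function.update (fun _ : Fin (p + 1) => 0) (Fin.last p) R.length i = R.length := by
    have := sum_update_add (fun _ : Fin (p + 1) => 0) (Fin.last p) R.length
    simpa using this
  rw [hsum] at hc'
  have hRn := hR.length_le
  have h1 : (c' : ℝ) ≤ (20 * D + 124) * t.leaves.length + c + 160 * A.length +
      (20 * D + 80) * (A.length + R.length) := by exact_mod_cast hc'
  have h2 : (R.length : ℝ) ≤ t.leaves.length := by exact_mod_cast hRn
  have h3 : (B.length : ℝ) ≤ 2 * A.length := by exact_mod_cast hB
  have h4 : (B.length : ℝ) * f ≤ 2 * A.length * f := by gcongr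
  have h5 : (20 * (D : ℝ) + 80) * R.length ≤ (20 * D + 80) * t.leaves.length := by gcongr
  linarith

/-- The sequence is cut into pieces of `n` accesses. The set-up cost `H` of a full piece is spread
over its accesses, giving `g / n + 40 * D + 204` each; only the last piece leaves it as an additive
term. -/
theorem ServedWithin.step {p D n : ℕ} {f g : ℝ} (hp : 1 ≤ p) (hpn : p < n) (hn : n < 2 ^ p)
    (hD : n ≤ k ^ D) (hf : 0 ≤ f) (hg : 0 ≤ g) (h : ServedWithin k (p + 1) f g) :
    ServedWithin k n (2 * f + (60 * D + 444) + g / n) (g + (40 * D + 204) * n) := by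
  intro α t A hnd hlen hA
  have hn0 : (0 : ℝ) < n := by exact_mod_cast (by omega : 0 < n)
  obtain ⟨F, hF⟩ : ∃ F, F = 2 * f + (60 * D + 444) + g / n := ⟨_, rfl⟩
  obtain ⟨H, hH⟩ : ∃ H, H = g + (40 * (D : ℝ) + 204) * n := ⟨_, rfl⟩
  have hFH : n * F = n * (2 * f + (20 * D + 240)) + H := by
    rw [hF, hH]; field_simp; ring
  have hH0 : 0 ≤ H := by rw [hH]; positivity
  have hle : 2 * f + (20 * D + 240) ≤ F := by
    rw [hF]
    have : 0 ≤ g / n := by positivity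
    have : (0 : ℝ) ≤ D := by positivity
    linarith
  rw [← hF, ← hH]
  induction hm : A.length using Nat.strong_induction_on generalizing t A with
  | _ m ih =>
  by_cases hmn : m ≤ n
  · obtain ⟨t', c, hS, hc⟩ := ServedWithin.short hp hpn hn hD hf h hnd hlen hA (by omega)
    refine ⟨t', c, hS, hc.trans ?_⟩
    rw [hm, hH]
    gcongr
  · push Not at hmn
    have hsub : ∀ x ∈ A.take n, x ∈ t.leaves := fun x hx => hA x (List.mem_of_mem_take hx)
    have hl1 : (A.take n).length = n := by rw [List.length_take]; omega
    obtain ⟨t₁, c₁, hS₁, hc₁⟩ := ServedWithin.short hp hpn hn hD hf h hnd hlen hsub hl1.le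
    have hperm := hS₁.leaves_perm
    obtain ⟨t₂, c₂, hS₂, hc₂⟩ := ih (A.drop n).length (by rw [List.length_drop]; omega) t₁ (A.drop n)
      (hperm.nodup_iff.1 hnd) (hperm.length_eq ▸ hlen)
      (fun x hx => hperm.subset (hA x (List.mem_of_mem_drop hx))) rfl
    refine ⟨t₂, c₁ + c₂, by simpa using hS₁.append hS₂, ?_⟩
    rw [hl1, ← hH, ← hFH] at hc₁
    have hl2 : ((A.drop n).length : ℝ) = m - n := by
      rw [List.length_drop, hm, Nat.cast_sub hmn.le]
    rw [hl2] at hc₂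
    push_cast
    linarith

theorem add_two_pow_four_le {q : ℕ} (hq : 20 ≤ q) : (q + 2) ^ 4 ≤ 2 ^ q := by
  induction q, hq using Nat.le_induction with
  | base => norm_num
  | succ q hq ih =>
    rw [pow_succ 2]
    obtain ⟨d, rfl⟩ := Nat.exists_eq_add_of_le hq
    refine le_trans ?_ (Nat.mul_le_mul_right 2 ih)
    ring_nf
    nlinarith [Nat.zero_le d, Nat.zero_le (d ^ 2), Nat.zero_le (d ^ 3), Nat.zero_le (d ^ 4)]

/-- The recursion passes from `n` to `⌊log₂ n⌋ + 2`, not to `log₂ n`; comparing with a real `y` up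
to slack `2 ^ 20` absorbs this at every level. The term `-750` absorbs additive constants: doubled,
it leaves room for 60 + 444 + 244 = 748. -/
theorem servedWithin_iterate (hk : 2 ≤ k) (j : ℕ) (y : ℝ) (n : ℕ) (hn : 1 ≤ n)
    (hny : (n : ℝ) ≤ y + 2 ^ 20) (hj : (Real.logb 2)^[j] y ≤ 1) :
    ServedWithin k n (24000000 * 2 ^ j + 1500 * Real.logb k n - 750)
      (488 * n * (1 + Real.logb k n)) := by
  have hk1 : (1 : ℝ) < k := by exact_mod_cast (by omega : 1 < k)
  have hlog : ∀ {i : ℕ}, 1 ≤ i → 0 ≤ Real.logb k i := fun hi =>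
    Real.logb_nonneg hk1 (by exact_mod_cast hi)
  induction j generalizing y n with
  | zero =>
    have hL := hlog hn
    refine (ServedWithin.naive k n).mono ?_ (by positivity)
    simp only [Function.iterate_zero, id] at hj
    linarith
  | succ j ih =>
    have hL := hlog hn
    by_cases hbase : (n : ℝ) ≤ 1 + 2 ^ 20
    · refine (ServedWithin.naive k n).mono ?_ (by positivity)
      have : (1 : ℝ) ≤ 2 ^ (j + 1) := one_le_pow₀ (by norm_num)
      linarith
    push Not at hbase
    have hy : 1 < y := by linarith
    have hn20 : 2 ^ 20 ≤ n := by
      have : ((2 ^ 20 : ℕ) : ℝ) ≤ n := by push_cast; linarith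
      exact_mod_cast this
    obtain ⟨q, hq⟩ : ∃ q, q = Nat.log 2 n := ⟨_, rfl⟩
    have hq20 : 20 ≤ q := by
      rw [hq]; exact Nat.le_log_of_pow_le (by norm_num) hn20
    have hqn : 2 ^ q ≤ n := by rw [hq]; exact Nat.pow_log_le_self 2 (by omega)
    have hnq : n < 2 ^ (q + 1) := by rw [hq]; exact Nat.lt_pow_succ_log_self (by norm_num) n
    have hr4 : (q + 2) ^ 4 ≤ n := (add_two_pow_four_le hq20).trans hqn
    have hr2 : 2 * (q + 2) ≤ n := by
      refine le_trans ?_ hr4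
      nlinarith [Nat.pow_le_pow_left (by omega : 2 ≤ q + 2) 3, pow_succ (q + 2) 3]
    have hry : ((q + 2 : ℕ) : ℝ) ≤ Real.logb 2 y + 2 ^ 20 := by
      have h1 : (q : ℝ) ≤ Real.logb 2 n := by rw [hq]; exact_mod_cast Real.natLog_le_logb n 2
      have h2 : Real.logb 2 n ≤ Real.logb 2 (2 ^ 21 * y) :=
        Real.logb_le_logb_of_le (by norm_num) (by linarith) (by nlinarith)
      have h3 : Real.logb 2 (2 ^ 21 * y) = 21 + Real.logb 2 y := by
        rw [Real.logb_mul (by positivity) (by linarith), Real.logb_pow, Real.logb_self_eq_one (by norm_num)]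
        norm_num
      push_cast
      linarith
    have hih := ih (Real.logb 2 y) (q + 2) (by omega) hry hj
    have hLr := hlog (by omega : 1 ≤ q + 2)
    -- The factor 4 beats the doubling: `2 * 1500 * Lr` is at most `750 * L`, which leaves space for
    -- the coefficients 60 and 244 of `L`.
    have h4 : 4 * Real.logb k ((q + 2 : ℕ) : ℝ) ≤ Real.logb k n := by
      have h1 : Real.logb k (((q + 2 : ℕ) : ℝ) ^ 4) ≤ Real.logb k n :=
        Real.logb_le_logb_of_le hk1 (by positivity) (by exact_mod_cast hr4)
      rw [Real.logb_pow] at h1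
      exact_mod_cast h1
    set Lr := Real.logb k ((q + 2 : ℕ) : ℝ) with hLr_def
    set L := Real.logb k (n : ℝ) with hL_def
    have hpow : (1 : ℝ) ≤ 2 ^ j := one_le_pow₀ (by norm_num)
    have hD : ((Nat.clog k n : ℕ) : ℝ) ≤ L + 1 := by
      rw [← Real.natCeil_logb_natCast]
      exact (Nat.ceil_lt_add_one hL).le
    have hr2' : 2 * ((q + 2 : ℕ) : ℝ) ≤ n := by exact_mod_cast hr2
    have hg : 488 * ((q + 2 : ℕ) : ℝ) * (1 + Lr) ≤ 244 * n * (1 + L) := by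
      have : ((q + 2 : ℕ) : ℝ) * (1 + Lr) ≤ n / 2 * (1 + L) := by
        gcongr
        · linarith
        · linarith
      linarith
    have hn0 : (0 : ℝ) < n := by exact_mod_cast (by omega : 0 < n)
    have hstep := ServedWithin.step (p := q + 1) (D := Nat.clog k n) (by omega) (by omega) hnq
      (Nat.le_pow_clog (by omega) n) (by linarith) (by positivity) hih
    refine hstep.mono ?_ ?_
    · have : 488 * ((q + 2 : ℕ) : ℝ) * (1 + Lr) / n ≤ 244 * (1 + L) := by
        rw [div_le_iff₀ hn0]; linarith
      rw [pow_succ]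
      linarith
    · have : (40 * ((Nat.clog k n : ℕ) : ℝ) + 204) * n ≤ 244 * (1 + L) * n := by
        gcongr; linarith
      linarith

end LeafTree

/-! ### The theorem -/

theorem theorem2 :
    ∃ C : ℝ, 0 < C ∧
      ∀ (n k : ℕ), 2 ≤ k →
      ∀ (V : Type*) [Finite V] (T : PointerTree V n), T.IsTournament →
      ∀ A : List (Fin n), n ≤ A.length →
      ∃ q : ℕ, T.CanServe k A q ∧
        (q : ℝ) ≤ C * ((A.length : ℝ) * (Real.logb (k : ℝ) (n : ℝ) + 2 ^ lgStar n)) := by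
  classical
  refine ⟨24002000, by norm_num, fun n k hk V _ T hT A hA => ?_⟩
  have : NeZero k := ⟨by omega⟩
  obtain ⟨t, ht⟩ := hT.exists_rep
  have hperm := hT.leaves_perm ht
  have hlen : t.leaves.length = n := by simpa using hperm.length_eq
  have hn : 1 ≤ n := hlen ▸ List.length_pos_iff.2 t.leaves_ne_nil
  have hL : 0 ≤ Real.logb k n := Real.logb_nonneg (by exact_mod_cast (by omega : 1 < k))
    (by exact_mod_cast hn)
  obtain ⟨t', c, hS, hc⟩ := LeafTree.servedWithin_iterate hk (lgStar n) n n hn (by norm_num)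
    (by unfold lgStar; exact Nat.find_spec (exists_iterate_logb_le_one (n : ℝ)))
    (Fin n) t A ht.nodup hlen fun x _ => hperm.symm.subset (List.mem_finRange x)
  obtain ⟨q, hq, hserve⟩ := hS.canServe hT ht
  refine ⟨q, hserve, ?_⟩
  have hq' : (q : ℝ) ≤ c + 2 * A.length := by exact_mod_cast hq
  have hA' : (n : ℝ) ≤ A.length := by exact_mod_cast hA
  -- Here `m ≥ n` turns the additive set-up cost into a cost per access.
  have h1 : (488 : ℝ) * n * (1 + Real.logb k n) ≤ 488 * A.length * (1 + Real.logb k n) := by gcongr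
  have hpow : (1 : ℝ) ≤ 2 ^ lgStar n := one_le_pow₀ (by norm_num)
  calc (q : ℝ) ≤ A.length * (24000000 * 2 ^ lgStar n + 1500 * Real.logb k n - 750) +
        488 * A.length * (1 + Real.logb k n) + 2 * A.length := by linarith
    _ = A.length * (24000000 * 2 ^ lgStar n + 1988 * Real.logb k n - 260) := by ring
    _ ≤ A.length * (24002000 * (Real.logb k n + 2 ^ lgStar n)) := by
        gcongr
        linarith
    _ = _ := by ring
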